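/- **Setting.** Let $\mathcal A$ (actions), $\mathcal O$ (observations) and $\mathcal R\subseteq[0,1]$ (rewards) be countable sets with fixed effective codings, $\mathcal H=\mathcal A\times\mathcal O\times\mathcal R$. A policy $\pi$ assigns to every finite history in $\mathcal H^*$ a distribution on $\mathcal A$; an environment $\nu$ assigns to every finite history and action a distribution on $\mathcal O\times\mathcal R$. Time starts at $0$, and $h_{<t}$ denotes the first $t$ interactions. Let $\gamma_t\ge 0$ with $\sum_t\gamma_t<\infty$, $\Gamma_t:=\sum_{k\ge t}\gamma_k>0$ for all $t$, and $$V^\pi_\nu(h_{<t})=\frac1{\Gamma_t}\,\mathbb E^\pi_\nu\Big[\sum_{k\ge t}\gamma_k r_k\,\Big|\,h_{<t}\Big],$$ where, after the given history $h_{<t}$, actions are drawn from $\pi$ and observations and rewards from $\nu$. Assume a bounded effective horizon: for all $\varepsilon>0$ there is $m$ such that $\Gamma_{t+m}/\Gamma_t<\varepsilon$ for all $t$. **The agent Mentee.** Let $\mathcal M$ be the set of all environments with computable probability distributions and $\mathcal P$ a countable set of policies, with prior distributions $w$ on $\mathcal M$ and on $\mathcal P$, both of finite entropy. Let $\mu\in\mathcal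 M$ be the true environment and $\pi^h\in\mathcal P$ the mentor's policy, with $w(\mu)>0$ and $w(\pi^h)>0$. Each time step also carries an exploration indicator $e_t\in\{0,1\}$, which is recorded in the history (policies, environments and $V^\pi_\nu$ ignore it). The posteriors are $$w(\nu\mid h_{<t})\propto w(\nu)\prod_{k<t}\nu(o_kr_k\mid h_{<k}a_k),\qquad w(\pi\mid h_{<t})\propto w(\pi)\prod_{k<t,\;e_k=1}\pi(a_k\mid h_{<k}),$$ (the prior, if the right-hand sides vanish identically), $w(\nu,\pi\mid h)=w(\nu\mid h)\,w(\pi\mid h)$, and the Bayes mixtures are $\xi(\cdot\mid h a)=\sum_\nu w(\nu\mid h)\nu(\cdot\mid h a)$ and $\overline\pi(\cdot\mid h)=\sum_\pi w(\pi\mid h)\pi(\cdot\mid h)$. Put $$\mathrm{IG}(h'\mid h)=\sum_{\nu\in\mathcal M}\sum_{\pi\in\mathcal P}w(\nu,\pi\mid hh')\log\frac{w(\nu,\pi\mid hh')}{w(\nu,\pi\mid h)},$$ let $V^{\mathrm{IG}}_{m,0}(h_{<t})$ be the expectation of $\mathrm{IG}(h_{t:t+m-1}\mid h_{<t})$ when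 the next $m$ steps all have $e=1$, actions are drawn from $\overline\pi$ and observations and rewards from $\xi$, and let $V^{\mathrm{IG}}_{m,k}(h_{<t})=V^{\mathrm{IG}}_{m,0}(h_{<t-k})$. For a constant $\eta>0$ the exploration probability is $$\beta(h_{<t})=\sum_{m\ge1}\ \sum_{k=0}^{\min\{m-1,t\}}\frac1{m^2(m+1)}\min\Big\{1,\frac\eta m V^{\mathrm{IG}}_{m,k}(h_{<t})\Big\}\in[0,1].$$ Let $\pi^*$ be a policy that maximizes $V^\pi_\xi(h)$ over all policies $\pi$, at every history $h$ (ties broken arbitrarily). Mentee draws $e_t\sim\mathrm{Bern}(\beta(h_{<t}))$ and then $a_t\sim\pi^h(\cdot\mid h_{<t})$ if $e_t=1$, $a_t\sim\pi^*(\cdot\mid h_{<t})$ if $e_t=0$; thus its policy is $\pi^M=\beta\,\pi^h+(1-\beta)\,\pi^*$. Let $\mathbb P^{\pi^M}_\mu$ be the law of the infinite history of Mentee in $\mu$, and $V^{\pi^M}_\mu(h_{<t})$ Mentee's value, i.e. the same normalized conditional expectation of future discounted reward under this interaction. **Theorem (Mentor-Level Reward Acquisition).** Under these assumptions, $$\liminf_{t\to\infty}\Big(V^{\pi^M}_\mu(h_{<t})-V^{\pi^h}_\mu(h_{<t})\Big)\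 \ge\ 0\qquad\text{with }\mathbb P^{\pi^M}_\mu\text{-probability }1.$$ -/

import Mathlib

open MeasureTheory ProbabilityTheory Filter
open scoped ENNReal NNReal

noncomputable section

namespace Mentee

/-! ### Trajectories of a history-dependent random process -/

section Trajectory

variable {S : Type*} [Countable S] [MeasurableSpace S] [DiscreteMeasurableSpace S]

/-- The Markov kernel that produces step number `n + 1` after the steps `0, …, n`, when the process
has started with the finite history `h` and the next step is always drawn from `K`. -/
def stepKernel (K : List S → PMF S) (h : List S) (n : ℕ) :
    Kernel (∀ _ : Finset.Iic n, S) S where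
  toFun x := (K (h ++ List.ofFn fun i : Fin (n + 1) =>
    x ⟨i, Finset.mem_Iic.2 (Nat.lt_succ_iff.1 i.2)⟩)).toMeasure
  measurable' := Measurable.of_discrete

instance (K : List S → PMF S) (h : List S) (n : ℕ) : IsMarkovKernel (stepKernel K h n) :=
  ⟨fun _ => PMF.toMeasure.isProbabilityMeasure _⟩

/-- The law of the infinite continuation `s₀ s₁ s₂ …` of the finite history `h`, where each new step
is drawn from `K` given the whole history so far. -/
def continuationLaw (K : List S → PMF S) (h : List S) : Measure (ℕ → S) :=
  Kernel.trajMeasure (X := fun _ => S) (K h).toMeasure (stepKernel K h)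

/-- The tail sum `Γ_t = ∑_{k ≥ t} γ_k`. -/
def tailSum (γ : ℕ → ℝ) (t : ℕ) : ℝ := ∑' k, γ (t + k)

/-- The normalised expected discounted reward after the history `h` (so `t = h.length`):
`Γ_t⁻¹ 𝔼[∑_{k ≥ t} γ_k r_k | h]`. -/
def value (γ : ℕ → ℝ) (rew : S → ℝ) (K : List S → PMF S) (h : List S) : ℝ :=
  (1 / tailSum γ h.length) *
    ∫ ω, ∑' k, γ (h.length + k) * rew (ω k) ∂(continuationLaw K h)

end Trajectory

/-- The finite history `h_{<t}`, the first `t` steps of an infinite history. -/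
def history {S : Type*} (ω : ℕ → S) (t : ℕ) : List S := List.ofFn fun i : Fin t => ω i

/-- A bounded effective horizon. -/
def BoundedHorizon (γ : ℕ → ℝ) : Prop :=
  ∀ ε : ℝ, 0 < ε → ∃ m : ℕ, ∀ t : ℕ, tailSum γ (t + m) / tailSum γ t < ε

/-! ### Policies and environments -/

/-- One interaction `(a, o, r)`: action, observation, reward. -/
abbrev Interaction (A O : Type*) (R : Set ℝ) := A × O × R

/-- One interaction `(e, a, o, r)` together with the exploration indicator `e`. -/
abbrev EInteraction (A O : Type*) (R : Set ℝ) := Bool × Interaction A O R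

/-- A policy: a distribution over actions for every finite history. -/
abbrev Policy (A O : Type*) (R : Set ℝ) := List (Interaction A O R) → PMF A

/-- An environment: a distribution over observations and rewards for every finite history and
action. -/
abbrev Environment (A O : Type*) (R : Set ℝ) := List (Interaction A O R) → A → PMF (O × R)

section Computable

/-- The rational number `p / (q + 1)` coded by a pair `(p, q)`. -/
def ratOfCode (c : ℤ × ℕ) : ℚ := c.1 / (c.2 + 1)

/-- A real function is computable if it has computable rational lower and upper bounds of any
prescribed accuracy. -/
def IsComputableReal {X : Type*} [Primcodable X] (f : X → ℝ) : Prop :=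
  ∃ lo hi : X → ℕ → ℤ × ℕ, Computable₂ lo ∧ Computable₂ hi ∧ ∀ x n,
    (ratOfCode (lo x n) : ℝ) ≤ f x ∧ f x ≤ (ratOfCode (hi x n) : ℝ) ∧
      ratOfCode (hi x n) - ratOfCode (lo x n) ≤ 1 / ((n : ℚ) + 1)

/-- The class of all environments with computable probability distributions. -/
def computableEnvironments (A O : Type*) (R : Set ℝ) [Primcodable A] [Primcodable O]
    [Primcodable R] : Set (Environment A O R) :=
  {ν | IsComputableReal fun x : (List (Interaction A O R) × A) × (O × R) =>
    (ν x.1.1 x.1.2 x.2).toReal}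

end Computable

section Interact

variable {A O : Type*} {R : Set ℝ}

/-- The reward of an interaction. -/
def reward (s : Interaction A O R) : ℝ := s.2.2

/-- Sampling one interaction: the action from `π`, then observation and reward from `ν`. -/
def interact (π : Policy A O R) (ν : Environment A O R) (h : List (Interaction A O R)) :
    PMF (Interaction A O R) :=
  (π h).bind fun a => (ν h a).map fun x => (a, x)

/-- The history with the exploration indicators forgotten. -/
def forget (h : List (EInteraction A O R)) : List (Interaction A O R) := h.map Prod.snd

/-- Sampling one interaction with exploration indicator: first the pair of indicator and action from
`c`, then observation and reward from `ν`. -/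
def eInteract (c : List (EInteraction A O R) → PMF (Bool × A)) (ν : Environment A O R)
    (h : List (EInteraction A O R)) : PMF (EInteraction A O R) :=
  (c h).bind fun b => (ν (forget h) b.2).map fun x => (b.1, b.2, x)

/-- `V^π_ν(h)`. -/
def policyValue [Countable A] [MeasurableSpace A] [DiscreteMeasurableSpace A]
    [Countable O] [MeasurableSpace O] [DiscreteMeasurableSpace O] [Countable R]
    (γ : ℕ → ℝ) (π : Policy A O R) (ν : Environment A O R) (h : List (Interaction A O R)) : ℝ :=
  value γ reward (interact π ν) h

/-- `π` maximises the value in the environment `ν` at every history. -/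
def IsOptimalPolicy [Countable A] [MeasurableSpace A] [DiscreteMeasurableSpace A]
    [Countable O] [MeasurableSpace O] [DiscreteMeasurableSpace O] [Countable R]
    (γ : ℕ → ℝ) (ν : Environment A O R) (π : Policy A O R) : Prop :=
  ∀ h π', policyValue γ π' ν h ≤ policyValue γ π ν h

end Interact

/-! ### Bayesian learning -/

/-- A discrete distribution has finite entropy `∑ w log (1 / w)` (all the terms are nonnegative). -/
def FiniteEntropy {I : Type*} (w : PMF I) : Prop :=
  Summable fun i => Real.negMulLog (w i).toReal

open Classical in
/-- Bayes' rule: the distribution proportional to `w i * L i`. Where normalisation is impossible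
(the data have probability zero under every model), the prior is kept. -/
def bayesUpdate {I : Type*} (w : PMF I) (L : I → ℝ≥0∞) : PMF I :=
  if h : ∑' i, w i * L i ≠ 0 ∧ ∑' i, w i * L i ≠ ∞ then
    PMF.normalize (fun i => w i * L i) h.1 h.2
  else w

/-- The Bernoulli distribution: `true` with probability `p`, `false` with probability `1 - p`. -/
def coin (p : ℝ≥0∞) (hp : p ≤ 1) : PMF Bool :=
  PMF.ofFintype (fun b => cond b p (1 - p)) (by simp [add_tsub_cancel_of_le hp])

section Bayes

variable {A O : Type*} {R : Set ℝ} {M : Set (Environment A O R)} {P : Set (Policy A O R)}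

/-- `∏_{k < t} ν(o_k r_k | h_{<k} a_k)`. -/
def envLikelihood (ν : Environment A O R) (h : List (Interaction A O R)) : ℝ≥0∞ :=
  ∏ k : Fin h.length, ν (h.take k) (h.get k).1 (h.get k).2

/-- `∏_{k < t, e_k = 1} π(a_k | h_{<k})`. -/
def policyLikelihood (π : Policy A O R) (h : List (EInteraction A O R)) : ℝ≥0∞ :=
  ∏ k : Fin h.length, if (h.get k).1 then π (forget (h.take k)) (h.get k).2.1 else 1

/-- The posterior `w(ν | h)` over environments. -/
def envPosterior (wM : PMF M) (h : List (Interaction A O R)) : PMF M :=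
  bayesUpdate wM fun ν => envLikelihood ν.1 h

/-- The posterior `w(π | h)` over mentor policies. -/
def policyPosterior (wP : PMF P) (h : List (EInteraction A O R)) : PMF P :=
  bayesUpdate wP fun π => policyLikelihood π.1 h

/-- The Bayes mixture environment `ξ`. -/
def mixtureEnv (wM : PMF M) : Environment A O R :=
  fun h a => (envPosterior wM h).bind fun ν => ν.1 h a

/-- The Bayes mixture `π̄` of the mentor policies. -/
def mixturePolicy (wP : PMF P) (h : List (EInteraction A O R)) : PMF A :=
  (policyPosterior wP h).bind fun π => π.1 (forget h)

/-- The joint posterior weight `w(ν, π | h) = w(ν | h) w(π | h)`. -/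
def jointPosterior (wM : PMF M) (wP : PMF P) (h : List (EInteraction A O R)) (p : M × P) : ℝ :=
  (envPosterior wM (forget h) p.1).toReal * (policyPosterior wP h p.2).toReal

/-- The information gain `IG(h' | h)`. -/
def infoGain (wM : PMF M) (wP : PMF P) (h h' : List (EInteraction A O R)) : ℝ :=
  ∑' p : M × P, jointPosterior wM wP (h ++ h') p *
    Real.log (jointPosterior wM wP (h ++ h') p / jointPosterior wM wP h p)

section Mentee

variable [Countable A] [MeasurableSpace A] [DiscreteMeasurableSpace A]
  [Countable O] [MeasurableSpace O] [DiscreteMeasurableSpace O] [Countable R]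

/-- `V^IG_{m,0}(h)`: the information gain of the next `m` steps, expected when they are all
exploratory, with actions from `π̄` and observations and rewards from `ξ`. -/
def infoGainValue (wM : PMF M) (wP : PMF P) (m : ℕ) (h : List (EInteraction A O R)) : ℝ≥0∞ :=
  ∫⁻ ω, ENNReal.ofReal (infoGain wM wP h (history ω m))
    ∂(continuationLaw
      (eInteract (fun h => (mixturePolicy wP h).map fun a => (true, a)) (mixtureEnv wM)) h)

/-- The exploration probability `β(h)`. The summand with indices `m`, `k` uses
`V^IG_{m,k}(h_{<t}) = V^IG_{m,0}(h_{<t-k})`, with `0 ≤ k ≤ min (m - 1) t`. -/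
def explorationProb (wM : PMF M) (wP : PMF P) (η : ℝ) (h : List (EInteraction A O R)) : ℝ≥0∞ :=
  ∑' m : ℕ, ∑ k ∈ Finset.range (min m (h.length + 1)),
    ENNReal.ofReal (1 / ((m : ℝ) ^ 2 * (m + 1))) *
      min 1 (ENNReal.ofReal (η / m) * infoGainValue wM wP m (h.take (h.length - k)))

theorem explorationProb_le_one (wM : PMF M) (wP : PMF P) (η : ℝ)
    (h : List (EInteraction A O R)) : explorationProb wM wP η h ≤ 1 := by
  have key : ∀ n : ℕ, ∑ m ∈ Finset.range (n + 1), (1 / ((m : ℝ) * (m + 1))) = 1 - 1 / (n + 1) := by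
    intro n
    induction n with
    | zero => simp
    | succ n ih =>
      rw [Finset.sum_range_succ, ih]
      push_cast
      field_simp
      ring
  refine ENNReal.tsum_le_of_sum_range_le fun n => ?_
  calc _ ≤ ∑ m ∈ Finset.range n, ENNReal.ofReal (1 / ((m : ℝ) * (m + 1))) := by
        refine Finset.sum_le_sum fun m _ => ?_
        calc _ ≤ ∑ _k ∈ Finset.range (min m (h.length + 1)),
              ENNReal.ofReal (1 / ((m : ℝ) ^ 2 * (m + 1))) :=
              Finset.sum_le_sum fun k _ => mul_le_of_le_one_right' (min_le_left _ _)
          _ ≤ m * ENNReal.ofReal (1 / ((m : ℝ) ^ 2 * (m + 1))) := by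
              rw [Finset.sum_const, Finset.card_range, nsmul_eq_mul]
              gcongr
              exact min_le_left _ _
          _ = ENNReal.ofReal (1 / ((m : ℝ) * (m + 1))) := by
              rw [← ENNReal.ofReal_natCast, ← ENNReal.ofReal_mul (Nat.cast_nonneg m)]
              congr 1
              rcases Nat.eq_zero_or_pos m with rfl | hm
              · simp
              · field_simp
    _ ≤ ∑ m ∈ Finset.range (n + 1), ENNReal.ofReal (1 / ((m : ℝ) * (m + 1))) :=
        Finset.sum_le_sum_of_subset (Finset.range_mono (Nat.le_succ n))
    _ = ENNReal.ofReal (1 - 1 / ((n : ℝ) + 1)) := by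
        rw [← ENNReal.ofReal_sum_of_nonneg (fun m _ => by positivity), key]
    _ ≤ 1 := by
        rw [ENNReal.ofReal_le_one]
        have : (0 : ℝ) ≤ 1 / ((n : ℝ) + 1) := by positivity
        linarith

/-- Mentee's choice of `(e, a)`: `e ∼ Bern(β(h))`; the action comes from the mentor `πh` if `e = 1`
and from the exploiting policy `πs` if `e = 0`. The action thus has the distribution
`π^M(· | h) = β(h) πh(· | h) + (1 - β(h)) πs(· | h)`. -/
def menteeChoice (wM : PMF M) (wP : PMF P) (η : ℝ) (πh πs : Policy A O R)
    (h : List (EInteraction A O R)) : PMF (Bool × A) :=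
  (coin (explorationProb wM wP η h) (explorationProb_le_one wM wP η h)).bind fun e =>
    ((if e then πh else πs) (forget h)).map fun a => (e, a)

/-- Sampling one step of Mentee's interaction with the environment `ν`. -/
def menteeStep (wM : PMF M) (wP : PMF P) (η : ℝ) (πh πs : Policy A O R) (ν : Environment A O R) :
    List (EInteraction A O R) → PMF (EInteraction A O R) :=
  eInteract (menteeChoice wM wP η πh πs) ν

/-- The law `ℙ^{π^M}_ν` of the infinite interaction history of Mentee with `ν`. -/
def menteeLaw (wM : PMF M) (wP : PMF P) (η : ℝ) (πh πs : Policy A O R) (ν : Environment A O R) :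
    Measure (ℕ → EInteraction A O R) :=
  continuationLaw (menteeStep wM wP η πh πs ν) []

/-- Mentee's value `V^{π^M}_ν(h)`. -/
def menteeValue (γ : ℕ → ℝ) (wM : PMF M) (wP : PMF P) (η : ℝ) (πh πs : Policy A O R)
    (ν : Environment A O R) (h : List (EInteraction A O R)) : ℝ :=
  value γ (fun s => reward s.2) (menteeStep wM wP η πh πs ν) h

end Mentee

end Bayes

end Mentee

end

/-! Mentee cannot keep exploring without learning, and what it has to learn is finite. The joint
posterior over (environment, mentor) is a Bayesian update for the process "coin `β`, mentor or `π*`,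
environment" whatever the exploration rule is, because `β` and `π*` do not depend on the hypothesis
and cancel. By the chain rule, the relative entropies of a component from the mixture, summed over
all times, are at most `log (1 / w)`. Averaged over the prior this is the entropy, which is finite
(`tsum_expect_tsum_pathKL_le`).

The expected information gain of `m` exploratory steps is the posterior average of the relative
entropies of those steps (`infoGainValue_eq`). The delayed terms in `β` keep the exploration
probability above a multiple of `y = min 1 (η V / m)` for `m` consecutive steps, where `V` is that
gain. Mentee therefore gains at least a multiple of `y ^ m * V`, and the expectations of `y ^ (m +
1)` are summable (`tsum_expect_explorationTerm_pow_ne_top`). So `V` tends to 0 almost surely, and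
`β` becomes small (`tsum_expect_explorationProb_sub_ne_top`). These facts pass from the mixture to
the true pair because the mixture dominates a positive multiple of it. Since the posterior weight of
the truth stays away from 0 (`ae_exists_le`), its own relative entropy under exploration vanishes
too.

The values are then compared in a chain (`policyValue_le_menteeValue_add`): mentor in `μ`, mentor in
`ξ` (exploration has been learnt), `π*` in `ξ` (optimality), Mentee in the mixture (`β` is small),
Mentee in `μ` (its own process has been learnt). A linear Pinsker inequality turns relative entropy
into total variation, and the bounded horizon limits every comparison to finitely many steps. -/

open MeasureTheory ProbabilityTheory Filter
open scoped ENNReal NNReal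

noncomputable section

namespace Mentee

/-! ### Expectations over finitely many steps -/

section Expectation

variable {S : Type*}

/-- The expectation of `f` of the history after one more step drawn from `K`. -/
def expectStep (K : List S → PMF S) (f : List S → ℝ≥0∞) (h : List S) : ℝ≥0∞ :=
  ∑' s, K h s * f (h ++ [s])

/-- The expectation of `f` of the history after `n` more steps drawn from `K`. -/
def expect (K : List S → PMF S) (n : ℕ) (f : List S → ℝ≥0∞) : List S → ℝ≥0∞ :=
  (expectStep K)^[n] f

variable {K : List S → PMF S} {f g : List S → ℝ≥0∞}

@[simp] theorem expect_zero : expect K 0 f = f := rfl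

theorem expect_one : expect K 1 f = expectStep K f := rfl

theorem expect_succ (n : ℕ) : expect K (n + 1) f = expectStep K (expect K n f) :=
  Function.iterate_succ_apply' _ _ _

theorem expect_succ' (n : ℕ) : expect K (n + 1) f = expect K n (expectStep K f) :=
  Function.iterate_succ_apply _ _ _

theorem expect_add_steps (m n : ℕ) : expect K (m + n) f = expect K m (expect K n f) :=
  Function.iterate_add_apply _ _ _ _

theorem expectStep_const (c : ℝ≥0∞) : expectStep K (fun _ => c) = fun _ => c := by
  funext h
  rw [expectStep, ENNReal.tsum_mul_right, PMF.tsum_coe, one_mul]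

theorem expect_const (n : ℕ) (c : ℝ≥0∞) : expect K n (fun _ => c) = fun _ => c := by
  induction n with
  | zero => rfl
  | succ n ih => rw [expect_succ, ih, expectStep_const]

/-- Expectations depend only on the values of `f` on a set that contains the initial history and is
closed under possible steps. -/
theorem expect_le_of_closed {G : List S → Prop} (hG : ∀ h s, G h → K h s ≠ 0 → G (h ++ [s]))
    (n : ℕ) (hfg : ∀ h, G h → f h ≤ g h) (h : List S) (hh : G h) :
    expect K n f h ≤ expect K n g h := by
  induction n generalizing h with
  | zero => exact hfg h hh
  | succ n ih =>
    rw [expect_succ, expect_succ]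
    refine ENNReal.tsum_le_tsum fun s => ?_
    by_cases hs : K h s = 0
    · simp [hs]
    · gcongr
      exact ih _ (hG h s hh hs)

theorem expect_congr_of_closed {G : List S → Prop} (hG : ∀ h s, G h → K h s ≠ 0 → G (h ++ [s]))
    (n : ℕ) (hfg : ∀ h, G h → f h = g h) (h : List S) (hh : G h) :
    expect K n f h = expect K n g h :=
  le_antisymm (expect_le_of_closed hG n (fun h hh => (hfg h hh).le) h hh)
    (expect_le_of_closed hG n (fun h hh => (hfg h hh).ge) h hh)

theorem expect_mono (n : ℕ) (hfg : ∀ h, f h ≤ g h) (h : List S) :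
    expect K n f h ≤ expect K n g h :=
  expect_le_of_closed (G := fun _ => True) (fun _ _ _ _ => trivial) n (fun h _ => hfg h) h trivial

theorem expectStep_mono (hfg : ∀ h, f h ≤ g h) (h : List S) :
    expectStep K f h ≤ expectStep K g h :=
  expect_mono (K := K) 1 hfg h

theorem expectStep_add (h : List S) :
    expectStep K (fun h => f h + g h) h = expectStep K f h + expectStep K g h := by
  simp only [expectStep, mul_add, ENNReal.tsum_add]

theorem expect_add (n : ℕ) :
    expect K n (fun h => f h + g h) = fun h => expect K n f h + expect K n g h := by
  induction n with
  | zero => rfl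
  | succ n ih => rw [expect_succ, ih]; funext h; rw [expectStep_add, expect_succ, expect_succ]

theorem expect_const_mul (n : ℕ) (c : ℝ≥0∞) :
    expect K n (fun h => c * f h) = fun h => c * expect K n f h := by
  induction n with
  | zero => rfl
  | succ n ih =>
    rw [expect_succ, ih, expect_succ]
    funext h
    simp only [expectStep, ← ENNReal.tsum_mul_left]
    exact tsum_congr fun s => mul_left_comm _ _ _

theorem expect_tsum {ι : Type*} (n : ℕ) (F : ι → List S → ℝ≥0∞) :
    expect K n (fun h => ∑' i, F i h) = fun h => ∑' i, expect K n (F i) h := by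
  induction n with
  | zero => rfl
  | succ n ih =>
    rw [expect_succ, ih]
    funext h
    simp only [expect_succ, expectStep, ← ENNReal.tsum_mul_left]
    exact ENNReal.tsum_comm

theorem expect_sum {ι : Type*} (n : ℕ) (t : Finset ι) (F : ι → List S → ℝ≥0∞) :
    expect K n (fun h => ∑ i ∈ t, F i h) = fun h => ∑ i ∈ t, expect K n (F i) h := by
  classical
  induction t using Finset.induction_on with
  | empty => simpa using expect_const (K := K) n 0
  | insert a t ha ih => simp only [Finset.sum_insert ha, expect_add, ih]

/-- A projection whose next step depends only on the projected history is again a process of this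
kind. This is what allows exploration indicators to be dropped. -/
theorem expect_comp_map {S' : Type*} {K' : List S' → PMF S'} (p : S → S')
    (hK : ∀ h, (K h).map p = K' (h.map p)) (n : ℕ) (F : List S' → ℝ≥0∞) (h : List S) :
    expect K n (fun h => F (h.map p)) h = expect K' n F (h.map p) := by
  induction n generalizing h with
  | zero => rfl
  | succ n ih =>
    rw [expect_succ, expect_succ]
    simp only [expectStep, ih, ← hK, PMF.map_apply, List.map_append, List.map_cons, List.map_nil,
      ← ENNReal.tsum_mul_right]
    rw [ENNReal.tsum_comm]
    refine tsum_congr fun s => ?_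
    rw [tsum_eq_single (p s)]
    · simp
    · intro b hb
      simp [hb]

theorem expect_congr_length (n : ℕ) {F G : List S → ℝ≥0∞} (h : List S)
    (hFG : ∀ g : List S, g.length = h.length + n → F g = G g) :
    expect K n F h = expect K n G h := by
  induction n generalizing h with
  | zero => exact hFG h (by simp)
  | succ n ih =>
    rw [expect_succ, expect_succ]
    refine tsum_congr fun s => ?_
    rw [ih _ fun g hg => hFG g (by rw [hg]; simp; omega)]

/-- The value of `y` at the history `k` steps ago. -/
theorem expect_take {y : List S → ℝ≥0∞} (k : ℕ) (h : List S) :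
    expect K k (fun g => y (g.take (g.length - k))) h = y h := by
  -- The induction moves the starting history, so it is generalised to all extensions of `h`.
  have : ∀ n (h' : List S), expect K n (fun g => y (g.take h.length)) (h ++ h') = y h := by
    intro n
    induction n with
    | zero => intro h'; simp
    | succ n ih =>
      intro h'
      rw [expect_succ]
      simp only [expectStep, List.append_assoc, ih, ENNReal.tsum_mul_right, PMF.tsum_coe, one_mul]
  rw [expect_congr_length k (G := fun g => y (g.take h.length)) h fun g hg => by simp [hg]]
  simpa using this k []

end Expectation

/-! ### Finite marginals of the trajectory measure -/

section Law

theorem history_succ {S : Type*} (ω : ℕ → S) (n : ℕ) :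
    history ω (n + 1) = history ω n ++ [ω n] := by
  rw [history, List.ofFn_succ_last]
  rfl

variable {S : Type*} [Countable S] [MeasurableSpace S] [DiscreteMeasurableSpace S]

instance (K : List S → PMF S) (h : List S) : IsProbabilityMeasure (continuationLaw K h) := by
  have : IsProbabilityMeasure (K h).toMeasure := PMF.toMeasure.isProbabilityMeasure _
  unfold continuationLaw
  infer_instance

theorem lintegral_toMeasure (p : PMF S) (f : S → ℝ≥0∞) :
    ∫⁻ s, f s ∂p.toMeasure = ∑' s, p s * f s := by
  rw [lintegral_countable']
  refine tsum_congr fun s => ?_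
  rw [PMF.toMeasure_apply_singleton _ _ (measurableSet_singleton s), mul_comm]

theorem measurable_history (n : ℕ) (f : List S → ℝ≥0∞) :
    Measurable fun ω : ℕ → S => f (history ω n) := by
  have h1 : Measurable fun ω : ℕ → S => fun i : Fin n => ω i := by fun_prop
  exact (Measurable.of_discrete (f := fun x : Fin n → S => f (List.ofFn x))).comp h1

theorem map_frestrictLe_continuationLaw (K : List S → PMF S) (h : List S) (n : ℕ) :
    (continuationLaw K h).map (Preorder.frestrictLe n) ⊗ₘ stepKernel K h n =
      (continuationLaw K h).map (fun x => (Preorder.frestrictLe n x, x (n + 1))) := by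
  have : IsProbabilityMeasure (K h).toMeasure := PMF.toMeasure.isProbabilityMeasure _
  exact Kernel.map_frestrictLe_trajMeasure_compProd_eq_map_trajMeasure

theorem map_zero_continuationLaw (K : List S → PMF S) (h : List S) :
    (continuationLaw K h).map (fun ω => ω 0) = (K h).toMeasure := by
  have : IsProbabilityMeasure (K h).toMeasure := PMF.toMeasure.isProbabilityMeasure _
  have e : (fun ω : ℕ → S => ω 0) =
      (fun x : (∀ _ : Finset.Iic 0, S) => x ⟨0, by simp⟩) ∘ Preorder.frestrictLe 0 := rfl
  rw [e, ← Measure.map_map (by fun_prop) (by fun_prop), continuationLaw, Kernel.trajMeasure,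
    Measure.map_comp _ _ (by fun_prop), Kernel.traj_map_frestrictLe, Kernel.partialTraj_self,
    Measure.id_comp, Measure.map_map (by fun_prop) (by fun_prop)]
  convert Measure.map_id
  rfl

/-- The first `n` steps of the infinite continuation. -/
theorem lintegral_continuationLaw (K : List S → PMF S) (h : List S) (n : ℕ) (f : List S → ℝ≥0∞) :
    ∫⁻ ω, f (h ++ history ω n) ∂continuationLaw K h = expect K n f h := by
  induction n generalizing f with
  | zero => simp [history]
  | succ n ih =>
    rw [expect_succ', ← ih]
    -- The first new step comes from the initial measure `K h`, all later ones from `stepKernel`.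
    cases n with
    | zero =>
      have e : ∀ ω : ℕ → S, f (h ++ history ω (0 + 1)) = (fun s => f (h ++ [s])) (ω 0) := by
        intro ω; simp [history]
      simp only [e]
      rw [← lintegral_map (f := fun s => f (h ++ [s])) Measurable.of_discrete (by fun_prop),
        map_zero_continuationLaw, lintegral_toMeasure]
      simp [history, expectStep]
    | succ n =>
      let F : (∀ _ : Finset.Iic n, S) × S → ℝ≥0∞ := fun x =>
        f (h ++ (List.ofFn fun i : Fin (n + 1) =>
          x.1 ⟨i, Finset.mem_Iic.2 (Nat.lt_succ_iff.1 i.2)⟩) ++ [x.2])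
      have e : ∀ ω : ℕ → S, f (h ++ history ω (n + 1 + 1)) =
          F (Preorder.frestrictLe n ω, ω (n + 1)) := by
        intro ω
        rw [history_succ, ← List.append_assoc]
        rfl
      simp only [e]
      have hF : Measurable F := Measurable.of_discrete
      rw [← lintegral_map (f := F) (g := fun ω : ℕ → S => (Preorder.frestrictLe n ω, ω (n + 1)))
        hF (by fun_prop), ← map_frestrictLe_continuationLaw, Measure.lintegral_compProd hF,
        lintegral_map Measurable.of_discrete (by fun_prop)]
      refine lintegral_congr fun ω => ?_
      change ∫⁻ s, F (Preorder.frestrictLe n ω, s) ∂(K _).toMeasure = _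
      rw [lintegral_toMeasure]
      rfl

end Law

/-! ### Relative entropy -/

/-- The nonnegative form `p log (p / q) - p + q` of the summands of a relative entropy. It is
meaningful if `p` and `q` are finite and `p = 0` whenever `q = 0`. -/
def klTerm (p q : ℝ≥0∞) : ℝ≥0∞ :=
  ENNReal.ofReal (p.toReal * Real.log (p.toReal / q.toReal) - p.toReal + q.toReal)

/-- Relative entropy dominates the squared Hellinger distance term by term: apply `log x ≤ x - 1` at
`x = √q / √p`. -/
theorem sq_sqrt_sub_sqrt_le {p q : ℝ} (hp : 0 ≤ p) (hq : 0 ≤ q) (h : q = 0 → p = 0) :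
    (√p - √q) ^ 2 ≤ p * Real.log (p / q) - p + q := by
  rcases hp.eq_or_lt with rfl | hp'
  · simp [Real.sq_sqrt hq]
  have hq' : 0 < q := hq.lt_of_ne fun e => hp'.ne' (h e.symm)
  have h1 := Real.log_le_sub_one_of_pos (div_pos (Real.sqrt_pos.2 hq') (Real.sqrt_pos.2 hp'))
  have h2 : Real.log (p / q) = -(2 * Real.log (√q / √p)) := by
    rw [Real.log_div hp'.ne' hq'.ne', Real.log_div (Real.sqrt_pos.2 hq').ne'
      (Real.sqrt_pos.2 hp').ne', Real.log_sqrt hq, Real.log_sqrt hp]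
    ring
  have h3 : p * (√q / √p) = √p * √q := by
    have : √p ≠ 0 := (Real.sqrt_pos.2 hp').ne'
    field_simp
    rw [Real.sq_sqrt hp]
  rw [h2]
  nlinarith [Real.sq_sqrt hp, Real.sq_sqrt hq, mul_le_mul_of_nonneg_left h1 hp]

theorem klReal_nonneg {p q : ℝ} (hp : 0 ≤ p) (hq : 0 ≤ q) (h : q = 0 → p = 0) :
    0 ≤ p * Real.log (p / q) - p + q :=
  (sq_nonneg _).trans (sq_sqrt_sub_sqrt_le hp hq h)

theorem toReal_eq_zero_imp {p q : ℝ≥0∞} (hq : q ≠ ∞) (h : q = 0 → p = 0) :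
    q.toReal = 0 → p.toReal = 0 := fun e => by
  rw [h (((ENNReal.toReal_eq_zero_iff q).1 e).resolve_right hq), ENNReal.toReal_zero]

@[simp] theorem klTerm_self (p : ℝ≥0∞) : klTerm p p = 0 := by
  rw [klTerm]
  rcases eq_or_ne p.toReal 0 with h | h
  · simp [h]
  · simp [div_self h]

theorem klTerm_mul (c p q : ℝ≥0∞) :
    klTerm (c * p) (c * q) = ENNReal.ofReal c.toReal * klTerm p q := by
  rw [klTerm, klTerm, ENNReal.toReal_mul, ENNReal.toReal_mul,
    ← ENNReal.ofReal_mul ENNReal.toReal_nonneg]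
  congr 1
  rcases eq_or_ne c.toReal 0 with h | h
  · simp [h]
  · rw [mul_div_mul_left _ _ h]
    ring

/-- A pointwise form of Pinsker's inequality, linear in the relative entropy. -/
theorem sub_le_klTerm {p q : ℝ≥0∞} (hp : p ≠ ∞) (hq : q ≠ ∞) (h : q = 0 → p = 0) {δ : ℝ}
    (hδ : 0 < δ) :
    max (p - q) (q - p) ≤
      ENNReal.ofReal δ * (p + q) + ENNReal.ofReal δ⁻¹ * klTerm p q := by
  lift p to ℝ≥0 using hp
  lift q to ℝ≥0 using hq
  have h' : (q : ℝ) = 0 → (p : ℝ) = 0 := by simpa using h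
  have key := sq_sqrt_sub_sqrt_le p.coe_nonneg q.coe_nonneg h'
  have hp := Real.sq_sqrt p.coe_nonneg
  have hq := Real.sq_sqrt q.coe_nonneg
  have main : |(p : ℝ) - q| ≤ δ * (p + q) + δ⁻¹ * (p * Real.log (p / q) - p + q) := by
    -- Factor the difference, then split the product by a weighted arithmetic-geometric mean
    -- inequality with free parameter `δ`.
    have h1 : (p : ℝ) - q = (√p - √q) * (√p + √q) := by linear_combination hq - hp
    have h2 : |(p : ℝ) - q| ≤ δ * (p + q) + δ⁻¹ * (√p - √q) ^ 2 := by
      have e1 : ∀ a b : ℝ, a * b ≤ δ / 2 * b ^ 2 + δ⁻¹ * a ^ 2 := by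
        intro a b
        have : 0 ≤ (δ * b - a) ^ 2 * δ⁻¹ / 2 := by positivity
        have e : (δ * b - a) ^ 2 * δ⁻¹ / 2 = δ / 2 * b ^ 2 - a * b + δ⁻¹ * a ^ 2 / 2 := by
          field_simp
          ring
        have : 0 ≤ δ⁻¹ * a ^ 2 / 2 := by positivity
        linarith
      have e2 : δ / 2 * (√p + √q) ^ 2 ≤ δ * (p + q) := by
        nlinarith [mul_nonneg hδ.le (sq_nonneg (√(p : ℝ) - √q))]
      rw [h1, abs_le]
      constructor
      · have := e1 (-(√p - √q)) (√p + √q)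
        nlinarith
      · have := e1 (√p - √q) (√p + √q)
        linarith
    refine h2.trans ?_
    gcongr
  have e : ENNReal.ofReal δ * ((p : ℝ≥0∞) + q) + ENNReal.ofReal δ⁻¹ * klTerm p q =
      ENNReal.ofReal (δ * (p + q) + δ⁻¹ * (p * Real.log (p / q) - p + q)) := by
    have := klReal_nonneg p.coe_nonneg q.coe_nonneg h'
    rw [ENNReal.ofReal_add (by positivity) (mul_nonneg (by positivity) this),
      ENNReal.ofReal_mul hδ.le, ENNReal.ofReal_mul (by positivity),
      ENNReal.ofReal_add p.coe_nonneg q.coe_nonneg]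
    simp [klTerm]
  rw [e, max_le_iff]
  constructor
  · rw [← ENNReal.ofReal_coe_nnreal, ← ENNReal.ofReal_coe_nnreal (p := q),
      ← ENNReal.ofReal_sub _ q.coe_nonneg]
    exact ENNReal.ofReal_le_ofReal ((le_abs_self _).trans main)
  · rw [← ENNReal.ofReal_coe_nnreal, ← ENNReal.ofReal_coe_nnreal (p := p),
      ← ENNReal.ofReal_sub _ p.coe_nonneg]
    exact ENNReal.ofReal_le_ofReal ((neg_sub (p : ℝ) q ▸ neg_le_abs _).trans main)

/-- The information content `log (1 / w)`. -/
def surprisal (w : ℝ≥0∞) : ℝ≥0∞ := ENNReal.ofReal (-Real.log w.toReal)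

/-- By Bayes' rule `p / q = w' / w`, so the log-likelihood ratio is exactly the drop in surprisal.
All terms are moved to the side where they are added, since `ℝ≥0∞` has no true subtraction. -/
theorem klTerm_add_surprisal {p q w w' : ℝ≥0∞} (hp : p ≤ 1) (hq : q ≤ 1) (hw : w ≤ 1)
    (hw' : w' ≤ 1) (hw0 : w ≠ 0) (h : w' * q = w * p) :
    klTerm p q + p * surprisal w' + p = p * surprisal w + q := by
  have hqp : q = 0 → p = 0 := by
    rintro rfl
    simpa [hw0] using h.symm
  lift p to ℝ≥0 using ne_top_of_le_ne_top ENNReal.one_ne_top hp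
  lift q to ℝ≥0 using ne_top_of_le_ne_top ENNReal.one_ne_top hq
  lift w to ℝ≥0 using ne_top_of_le_ne_top ENNReal.one_ne_top hw
  lift w' to ℝ≥0 using ne_top_of_le_ne_top ENNReal.one_ne_top hw'
  have hkl := klReal_nonneg p.coe_nonneg q.coe_nonneg (by simpa using hqp)
  have hu : ∀ v : ℝ≥0, v ≤ 1 → 0 ≤ -Real.log v := fun v hv =>
    neg_nonneg.2 (Real.log_nonpos v.coe_nonneg hv)
  norm_cast at hw hw' hw0 h
  have h1 := hu w hw
  have h2 := hu w' hw'
  have lhs : klTerm (p : ℝ≥0∞) q + p * surprisal w' + p =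
      ENNReal.ofReal ((p * Real.log (p / q) - p + q) + p * -Real.log w' + p) := by
    rw [ENNReal.ofReal_add (add_nonneg hkl (mul_nonneg p.coe_nonneg h2)) p.coe_nonneg,
      ENNReal.ofReal_add hkl (mul_nonneg p.coe_nonneg h2), ENNReal.ofReal_mul p.coe_nonneg]
    simp [klTerm, surprisal]
  have rhs : (p : ℝ≥0∞) * surprisal w + q = ENNReal.ofReal (p * -Real.log w + q) := by
    rw [ENNReal.ofReal_add (mul_nonneg p.coe_nonneg h1) q.coe_nonneg,
      ENNReal.ofReal_mul p.coe_nonneg]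
    simp [surprisal]
  rw [lhs, rhs]
  congr 1
  rcases eq_or_ne p 0 with rfl | hp0
  · simp
  have hq0 : q ≠ 0 := fun e => hp0 (by simpa [e] using hqp)
  have hw'0 : w' ≠ 0 := fun e => by
    rw [e, zero_mul] at h
    exact mul_ne_zero hw0 hp0 h.symm
  have hr : (w' : ℝ) * q = w * p := by exact_mod_cast h
  have hlog : Real.log w' + Real.log q = Real.log w + Real.log p := by
    rw [← Real.log_mul (by positivity) (by positivity), hr,
      Real.log_mul (by positivity) (by positivity)]
  rw [Real.log_div (by positivity) (by positivity)]
  linear_combination -(p : ℝ) * hlog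

/-- Bayes' rule gives `log (w' / v) = log (w / v) + log (p / q)`. This is the chain rule for the
divergence of the posterior from a fixed reference weight `v`, before summation over outcomes. -/
theorem mul_klTerm_posterior {p q w w' v : ℝ≥0∞} (hp : p ≤ 1) (hq : q ≤ 1) (hw : w ≤ 1)
    (hw' : w' ≤ 1) (hv : v ≤ 1) (hvw : v = 0 → w = 0) (h : w' * q = w * p) :
    q * klTerm w' v + p * v + w * q = p * klTerm w v + w * klTerm p q + w * p + q * v := by
  rcases eq_or_ne w 0 with rfl | hw0
  · rw [zero_mul, mul_eq_zero] at h
    have hz : klTerm 0 v = v := by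
      simp [klTerm, ENNReal.ofReal_toReal (ne_top_of_le_ne_top ENNReal.one_ne_top hv)]
    rcases h with rfl | rfl <;> simp [hz, add_comm]
  have hqp : q = 0 → p = 0 := by
    rintro rfl
    simpa [hw0] using h.symm
  rcases eq_or_ne q 0 with rfl | hq0
  · simp [hqp]
  have hvw' : v ≠ 0 := fun e => hw0 (hvw e)
  lift p to ℝ≥0 using ne_top_of_le_ne_top ENNReal.one_ne_top hp
  lift q to ℝ≥0 using ne_top_of_le_ne_top ENNReal.one_ne_top hq
  lift w to ℝ≥0 using ne_top_of_le_ne_top ENNReal.one_ne_top hw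
  lift w' to ℝ≥0 using ne_top_of_le_ne_top ENNReal.one_ne_top hw'
  lift v to ℝ≥0 using ne_top_of_le_ne_top ENNReal.one_ne_top hv
  norm_cast at hw0 h hq0 hvw'
  have k1 := klReal_nonneg w'.coe_nonneg v.coe_nonneg (by simp [hvw'])
  have k2 := klReal_nonneg w.coe_nonneg v.coe_nonneg (by simp [hvw'])
  have k3 := klReal_nonneg p.coe_nonneg q.coe_nonneg (by simp [hq0])
  have lhs : (q : ℝ≥0∞) * klTerm w' v + p * v + w * q =
      ENNReal.ofReal (q * (w' * Real.log (w' / v) - w' + v) + p * v + w * q) := by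
    rw [ENNReal.ofReal_add (by positivity) (by positivity),
      ENNReal.ofReal_add (by positivity) (by positivity), ENNReal.ofReal_mul q.coe_nonneg,
      ENNReal.ofReal_mul p.coe_nonneg, ENNReal.ofReal_mul w.coe_nonneg]
    simp [klTerm]
  have rhs : (p : ℝ≥0∞) * klTerm w v + w * klTerm p q + w * p + q * v =
      ENNReal.ofReal (p * (w * Real.log (w / v) - w + v) + w * (p * Real.log (p / q) - p + q)
        + w * p + q * v) := by
    rw [ENNReal.ofReal_add (by positivity) (by positivity),
      ENNReal.ofReal_add (by positivity) (by positivity),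
      ENNReal.ofReal_add (by positivity) (by positivity), ENNReal.ofReal_mul p.coe_nonneg,
      ENNReal.ofReal_mul w.coe_nonneg, ENNReal.ofReal_mul w.coe_nonneg,
      ENNReal.ofReal_mul q.coe_nonneg]
    simp [klTerm]
  rw [lhs, rhs]
  congr 1
  have hr : (w' : ℝ) * q = w * p := by exact_mod_cast h
  rcases eq_or_ne p 0 with rfl | hp0
  · have : w' = 0 := by
      rw [mul_zero] at h
      exact (mul_eq_zero.1 h).resolve_right hq0
    simp [this]
    ring
  have hw'0 : w' ≠ 0 := fun e => by
    rw [e, zero_mul] at h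
    exact mul_ne_zero hw0 hp0 h.symm
  have hlog : Real.log w' + Real.log q = Real.log w + Real.log p := by
    rw [← Real.log_mul (by positivity) (by positivity), hr,
      Real.log_mul (by positivity) (by positivity)]
  rw [Real.log_div (by positivity) (by positivity), Real.log_div (by positivity) (by positivity),
    Real.log_div (by positivity) (by positivity)]
  have e : Real.log w' = Real.log w + Real.log p - Real.log q := by linarith
  rw [e]
  linear_combination (Real.log w + Real.log p - Real.log q - Real.log v - 1) * hr

/-! ### Comparing processes -/

section Compare

variable {S : Type*}

/-- The relative entropy of the next step. -/
def stepKL (K₁ K₂ : List S → PMF S) (h : List S) : ℝ≥0∞ := ∑' s, klTerm (K₁ h s) (K₂ h s)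

/-- The relative entropy of the next `n` steps, by the chain rule. -/
def pathKL (K₁ K₂ : List S → PMF S) (n : ℕ) (h : List S) : ℝ≥0∞ :=
  ∑ j ∈ Finset.range n, expect K₁ j (stepKL K₁ K₂) h

/-- The total variation distance of the next steps. -/
def stepTV (K₁ K₂ : List S → PMF S) (h : List S) : ℝ≥0∞ := ∑' s, (K₁ h s - K₂ h s)

theorem expect_le_one {K : List S → PMF S} {F : List S → ℝ≥0∞} (hF : ∀ h, F h ≤ 1) (n : ℕ)
    (h : List S) : expect K n F h ≤ 1 :=
  (expect_mono n hF h).trans (by rw [expect_const])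

theorem expectStep_le_add_stepTV (K₁ K₂ : List S → PMF S) {F : List S → ℝ≥0∞}
    (hF : ∀ h, F h ≤ 1) (h : List S) :
    expectStep K₁ F h ≤ expectStep K₂ F h + stepTV K₁ K₂ h := by
  rw [expectStep, expectStep, stepTV, ← ENNReal.tsum_add]
  refine ENNReal.tsum_le_tsum fun s => ?_
  calc K₁ h s * F (h ++ [s]) ≤ (K₂ h s + (K₁ h s - K₂ h s)) * F (h ++ [s]) := by
        gcongr
        exact le_add_tsub
    _ ≤ K₂ h s * F (h ++ [s]) + (K₁ h s - K₂ h s) := by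
        rw [add_mul]
        gcongr
        exact mul_le_of_le_one_right' (hF _)

theorem add_sum_expect_succ (K : List S → PMF S) (n : ℕ) (d : List S → ℝ≥0∞) (h : List S) :
    d h + expectStep K (fun g => ∑ j ∈ Finset.range n, expect K j d g) h =
      ∑ j ∈ Finset.range (n + 1), expect K j d h := by
  rw [Finset.sum_range_succ', add_comm, ← expect_one, expect_sum]
  simp only [expect_zero, expect_succ]

/-- The kernels are exchanged one step at a time. The errors are averaged along `K₁`, here the
process on the smaller side. -/
theorem expect_le_add_stepTV (K₁ K₂ : List S → PMF S) {F : List S → ℝ≥0∞} (hF : ∀ h, F h ≤ 1)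
    (n : ℕ) (h : List S) :
    expect K₁ n F h ≤
      expect K₂ n F h + ∑ j ∈ Finset.range n, expect K₁ j (stepTV K₁ K₂) h := by
  induction n generalizing h with
  | zero => simp
  | succ n ih =>
    rw [← add_sum_expect_succ, expect_succ, expect_succ]
    calc _ ≤ expectStep K₁ (fun g => expect K₂ n F g +
            ∑ j ∈ Finset.range n, expect K₁ j (stepTV K₁ K₂) g) h := expectStep_mono ih h
      _ ≤ _ := by
        rw [expectStep_add, ← add_assoc]
        gcongr
        exact expectStep_le_add_stepTV K₁ K₂ (expect_le_one hF n) h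

/-- Same exchange with the errors averaged along the process on the larger side; needed when only
that process is known to have small errors. -/
theorem expect_le_add_stepTV' (K₁ K₂ : List S → PMF S) {F : List S → ℝ≥0∞} (hF : ∀ h, F h ≤ 1)
    (n : ℕ) (h : List S) :
    expect K₂ n F h ≤
      expect K₁ n F h + ∑ j ∈ Finset.range n, expect K₁ j (stepTV K₂ K₁) h := by
  induction n generalizing h with
  | zero => simp
  | succ n ih =>
    rw [← add_sum_expect_succ, expect_succ, expect_succ]
    calc _ ≤ expectStep K₁ (expect K₂ n F) h + stepTV K₂ K₁ h :=
          expectStep_le_add_stepTV K₂ K₁ (expect_le_one hF n) h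
      _ ≤ expectStep K₁ (fun g => expect K₁ n F g +
            ∑ j ∈ Finset.range n, expect K₁ j (stepTV K₂ K₁) g) h + stepTV K₂ K₁ h := by
          gcongr
          exact expectStep_mono ih h
      _ = _ := by
        rw [expectStep_add]
        ring

theorem max_stepTV_le {K₁ K₂ : List S → PMF S} {h : List S} (hac : ∀ s, K₂ h s = 0 → K₁ h s = 0)
    {δ : ℝ} (hδ : 0 < δ) :
    max (stepTV K₁ K₂ h) (stepTV K₂ K₁ h) ≤
      2 * ENNReal.ofReal δ + ENNReal.ofReal δ⁻¹ * stepKL K₁ K₂ h := by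
  have e : ∑' s, (ENNReal.ofReal δ * (K₁ h s + K₂ h s) +
      ENNReal.ofReal δ⁻¹ * klTerm (K₁ h s) (K₂ h s)) =
      2 * ENNReal.ofReal δ + ENNReal.ofReal δ⁻¹ * stepKL K₁ K₂ h := by
    rw [ENNReal.tsum_add, ENNReal.tsum_mul_left, ENNReal.tsum_add, PMF.tsum_coe, PMF.tsum_coe,
      ENNReal.tsum_mul_left, stepKL, one_add_one_eq_two, mul_comm]
  have key s := sub_le_klTerm ((K₁ h).apply_ne_top s) ((K₂ h).apply_ne_top s) (hac s) hδ
  rw [← e]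
  exact max_le (ENNReal.tsum_le_tsum fun s => (le_max_left _ _).trans (key s))
    (ENNReal.tsum_le_tsum fun s => (le_max_right _ _).trans (key s))

/-- Summing over all times the expected `n`-step sums counts each step at most `n` times. -/
theorem tsum_expect_sum_expect_le (K : List S → PMF S) (n : ℕ) (d : List S → ℝ≥0∞) (h : List S) :
    ∑' t, expect K t (fun g => ∑ j ∈ Finset.range n, expect K j d g) h ≤
      n * ∑' t, expect K t d h := by
  simp only [expect_sum, ← expect_add_steps]
  rw [Summable.tsum_finsetSum fun _ _ => ENNReal.summable]
  calc _ ≤ ∑ _j ∈ Finset.range n, ∑' t, expect K t d h := by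
        refine Finset.sum_le_sum fun j _ => ?_
        exact ENNReal.tsum_comp_le_tsum_of_injective (add_left_injective j) _
    _ = _ := by simp

end Compare

/-! ### Bayesian mixtures of processes -/

/-- `W h i` are the posterior weights of the processes `K i`, with predictive mixture `Q`, at the
histories that satisfy `good`. -/
structure IsBayesMixture {S I : Type*} (good : List S → Prop) (W : List S → I → ℝ≥0∞)
    (K : I → List S → PMF S) (Q : List S → PMF S) : Prop where
  le_one : ∀ h i, W h i ≤ 1
  good_append : ∀ h s, good h → Q h s ≠ 0 → good (h ++ [s])
  update : ∀ h s i, good h → W (h ++ [s]) i * Q h s = W h i * K i h s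

namespace IsBayesMixture

variable {S I : Type*} {good : List S → Prop} {W : List S → I → ℝ≥0∞} {K : I → List S → PMF S}
  {Q : List S → PMF S}

theorem eq_zero_of_mixture_eq_zero (B : IsBayesMixture good W K Q)
    {h : List S} {i : I} (hh : good h) (hW : W h i ≠ 0) (s : S)
    (hs : Q h s = 0) : K i h s = 0 := by
  have := B.update h s i hh
  rw [hs, mul_zero] at this
  exact (mul_eq_zero.1 this.symm).resolve_left hW

theorem good_append_of_ne_zero (B : IsBayesMixture good W K Q)
    {h : List S} {s : S} {i : I} (hh : good h ∧ W h i ≠ 0)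
    (hs : K i h s ≠ 0) : good (h ++ [s]) ∧ W (h ++ [s]) i ≠ 0 := by
  refine ⟨B.good_append h s hh.1 fun e => hs (B.eq_zero_of_mixture_eq_zero hh.1 hh.2 s e),
    fun e => ?_⟩
  have := B.update h s i hh.1
  rw [e, zero_mul] at this
  exact mul_ne_zero hh.2 hs this.symm

/-- Change of measure from the mixture to one of its components. -/
theorem expect_mul (B : IsBayesMixture good W K Q)
    (i : I) (n : ℕ) (f : List S → ℝ≥0∞) (h : List S) (hh : good h) :
    expect Q n (fun g => W g i * f g) h = W h i * expect (K i) n f h := by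
  induction n generalizing h with
  | zero => rfl
  | succ n ih =>
    rw [expect_succ, expect_succ, expectStep, expectStep, ← ENNReal.tsum_mul_left]
    refine tsum_congr fun s => ?_
    rw [← mul_assoc, ← B.update h s i hh]
    by_cases hs : Q h s = 0
    · simp [hs]
    · rw [ih _ (B.good_append h s hh hs)]
      ring

/-- Posterior weights are at most one, so the mixture dominates the prior weight times each
component. Summability under `Q` thereby passes to the true process. -/
theorem expect_le_inv_mul (B : IsBayesMixture good W K Q)
    (hnil : good []) {i : I} (hi : W [] i ≠ 0) (f : List S → ℝ≥0∞) (t : ℕ) :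
    expect (K i) t f [] ≤ (W [] i)⁻¹ * expect Q t f [] := by
  have hit : W [] i ≠ ∞ := ne_top_of_le_ne_top ENNReal.one_ne_top (B.le_one _ i)
  calc expect (K i) t f [] = (W [] i)⁻¹ * (W [] i * expect (K i) t f []) := by
        rw [← mul_assoc, ENNReal.inv_mul_cancel hi hit, one_mul]
    _ ≤ _ := by
        rw [← B.expect_mul i t f [] hnil]
        gcongr
        exact expect_mono t (fun g => mul_le_of_le_one_left' (B.le_one g i)) []

theorem stepKL_add_surprisal (B : IsBayesMixture good W K Q)
    {i : I} {h : List S} (hh : good h ∧ W h i ≠ 0) :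
    stepKL (K i) Q h + expectStep (K i) (fun g => surprisal (W g i)) h = surprisal (W h i) := by
  have e : ∑' s, (klTerm (K i h s) (Q h s) + K i h s * surprisal (W (h ++ [s]) i) + K i h s) =
      ∑' s, (K i h s * surprisal (W h i) + Q h s) :=
    tsum_congr fun s => klTerm_add_surprisal ((K i h).coe_le_one s) ((Q h).coe_le_one s)
      (B.le_one h i) (B.le_one _ i) hh.2 (B.update h s i hh.1)
  rw [ENNReal.tsum_add, ENNReal.tsum_add, ENNReal.tsum_add, ENNReal.tsum_mul_right, PMF.tsum_coe,
    PMF.tsum_coe, one_mul] at e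
  exact (ENNReal.add_left_inj ENNReal.one_ne_top).1 e

/-- The relative entropy of a component with respect to the mixture is at most the information
content of its weight. -/
theorem pathKL_add_surprisal (B : IsBayesMixture good W K Q)
    {i : I} (n : ℕ) {h : List S} (hh : good h ∧ W h i ≠ 0) :
    pathKL (K i) Q n h + expect (K i) n (fun g => surprisal (W g i)) h = surprisal (W h i) := by
  induction n with
  | zero => simp [pathKL]
  | succ n ih =>
    rw [pathKL, Finset.sum_range_succ, expect_succ', add_assoc, ← ih, pathKL]
    congr 1
    have := expect_add (K := K i) (f := stepKL (K i) Q)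
      (g := expectStep (K i) (fun g => surprisal (W g i))) n
    rw [← congrFun this h]
    exact expect_congr_of_closed (G := fun g => good g ∧ W g i ≠ 0)
      (fun g s hg hs => B.good_append_of_ne_zero hg hs) n
      (fun g hg => B.stepKL_add_surprisal hg) h hh

theorem tsum_expect_stepKL_le (B : IsBayesMixture good W K Q)
    {i : I} {h : List S} (hh : good h ∧ W h i ≠ 0) :
    ∑' t, expect (K i) t (stepKL (K i) Q) h ≤ surprisal (W h i) :=
  ENNReal.tsum_le_of_sum_range_le fun n =>
    le_self_add.trans_eq (B.pathKL_add_surprisal n hh)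

/-- The reference `v` is kept apart from the current weight so that the steps of a window can be
chained with `v` fixed at its start. -/
theorem expectStep_klTerm (B : IsBayesMixture good W K Q)
    {i : I} {v : ℝ≥0∞} (hv : v ≤ 1) {h : List S}
    (hh : good h ∧ (v = 0 → W h i = 0)) :
    expectStep Q (fun g => klTerm (W g i) v) h =
      klTerm (W h i) v + W h i * stepKL (K i) Q h := by
  have e : ∑' s, (Q h s * klTerm (W (h ++ [s]) i) v + K i h s * v + W h i * Q h s) =
      ∑' s, (K i h s * klTerm (W h i) v + W h i * klTerm (K i h s) (Q h s) + W h i * K i h s +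
        Q h s * v) :=
    tsum_congr fun s => mul_klTerm_posterior ((K i h).coe_le_one s) ((Q h).coe_le_one s)
      (B.le_one h i) (B.le_one _ i) hv hh.2 (B.update h s i hh.1)
  simp only [ENNReal.tsum_add, ENNReal.tsum_mul_right, ENNReal.tsum_mul_left, PMF.tsum_coe,
    one_mul, mul_one] at e
  rw [add_assoc, add_assoc _ (W h i), add_comm v] at e
  exact (ENNReal.add_left_inj (ENNReal.add_ne_top.2
    ⟨ne_top_of_le_ne_top ENNReal.one_ne_top (B.le_one h i),
      ne_top_of_le_ne_top ENNReal.one_ne_top hv⟩)).1 e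

theorem expect_klTerm (B : IsBayesMixture good W K Q)
    {i : I} {v : ℝ≥0∞} (hv : v ≤ 1) (n : ℕ) {h : List S}
    (hh : good h ∧ (v = 0 → W h i = 0)) :
    expect Q n (fun g => klTerm (W g i) v) h =
      klTerm (W h i) v + W h i * pathKL (K i) Q n h := by
  induction n with
  | zero => simp [pathKL]
  | succ n ih =>
    rw [expect_succ', pathKL, Finset.sum_range_succ, mul_add, ← add_assoc, ← pathKL, ← ih,
      ← B.expect_mul i n _ h hh.1]
    have := expect_add (K := Q) (f := fun g => klTerm (W g i) v)
      (g := fun g => W g i * stepKL (K i) Q g) n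
    rw [← congrFun this h]
    refine expect_congr_of_closed (G := fun g => good g ∧ (v = 0 → W g i = 0))
      (fun g s hg hs => ⟨B.good_append g s hg.1 hs, fun hv0 => ?_⟩) n
      (fun g hg => B.expectStep_klTerm hv hg) h hh
    have := B.update g s i hg.1
    rw [hg.2 hv0, zero_mul] at this
    exact (mul_eq_zero.1 this).resolve_right hs

/-- The expected information gain of `n` steps. -/
theorem expect_tsum_klTerm (B : IsBayesMixture good W K Q) (n : ℕ) {h : List S} (hh : good h) :
    expect Q n (fun g => ∑' i, klTerm (W g i) (W h i)) h =
      ∑' i, W h i * pathKL (K i) Q n h := by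
  rw [expect_tsum]
  refine tsum_congr fun i => ?_
  rw [B.expect_klTerm (B.le_one h i) n ⟨hh, id⟩]
  simp

/-- The information gain of windows of `n` steps is finite in total. -/
theorem tsum_expect_tsum_pathKL_le (B : IsBayesMixture good W K Q)
    (n : ℕ) {h : List S} (hh : good h) :
    ∑' t, expect Q t (fun g => ∑' i, W g i * pathKL (K i) Q n g) h ≤
      n * ∑' i, W h i * surprisal (W h i) := by
  -- The change of measure reduces the claim to one component at a time, whose total relative
  -- entropy is at most its surprisal.
  simp only [expect_tsum, B.expect_mul _ _ _ h hh]
  rw [ENNReal.tsum_comm, ← ENNReal.tsum_mul_left]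
  refine ENNReal.tsum_le_tsum fun i => ?_
  rw [ENNReal.tsum_mul_left, mul_left_comm]
  rcases eq_or_ne (W h i) 0 with h0 | h0
  · simp [h0]
  · gcongr
    refine (tsum_expect_sum_expect_le (K i) n (stepKL (K i) Q) h).trans ?_
    gcongr
    exact B.tsum_expect_stepKL_le ⟨hh, h0⟩

end IsBayesMixture

/-! ### Posteriors -/

section BayesRule

variable {I : Type*} {w : PMF I} {L ℓ : I → ℝ≥0∞}

theorem tsum_mul_le_one (w : PMF I) (hL : ∀ i, L i ≤ 1) : ∑' i, w i * L i ≤ 1 :=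
  (ENNReal.tsum_le_tsum fun i => mul_le_of_le_one_right' (hL i)).trans_eq w.tsum_coe

theorem bayesUpdate_mul (hL : ∀ i, L i ≤ 1) (i : I) :
    bayesUpdate w L i * ∑' j, w j * L j = w i * L i := by
  have ht : ∑' j, w j * L j ≠ ∞ := ne_top_of_le_ne_top ENNReal.one_ne_top (tsum_mul_le_one w hL)
  by_cases h0 : ∑' j, w j * L j = 0
  · rw [h0, mul_zero, ENNReal.tsum_eq_zero.1 h0 i]
  · rw [bayesUpdate, dif_pos ⟨h0, ht⟩, PMF.normalize_apply, mul_assoc,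
      ENNReal.inv_mul_cancel h0 ht, mul_one]

theorem tsum_bayesUpdate_mul (hL : ∀ i, L i ≤ 1) :
    (∑' j, w j * L j) * ∑' j, bayesUpdate w L j * ℓ j = ∑' j, w j * (L j * ℓ j) := by
  rw [← ENNReal.tsum_mul_left]
  refine tsum_congr fun j => ?_
  rw [← mul_assoc, ← mul_assoc, mul_comm (∑' j, w j * L j), bayesUpdate_mul hL]

/-- Updating on two pieces of data is updating twice. The product form stays true when the new datum
has predictive probability zero; `h0` excludes the default to the prior for the old data. -/
theorem bayesUpdate_step (hL : ∀ i, L i ≤ 1) (hℓ : ∀ i, ℓ i ≤ 1)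
    (h0 : ∑' j, w j * L j ≠ 0) (i : I) :
    bayesUpdate w (fun i => L i * ℓ i) i * ∑' j, bayesUpdate w L j * ℓ j =
      bayesUpdate w L i * ℓ i := by
  have ht : ∑' j, w j * L j ≠ ∞ := ne_top_of_le_ne_top ENNReal.one_ne_top (tsum_mul_le_one w hL)
  refine (ENNReal.mul_right_inj h0 ht).1 ?_
  rw [mul_left_comm, tsum_bayesUpdate_mul hL,
    bayesUpdate_mul (L := fun i => L i * ℓ i) fun i => mul_le_one' (hL i) (hℓ i), ← mul_assoc,
    ← mul_assoc, mul_comm (∑' j, w j * L j), bayesUpdate_mul hL]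

theorem bayesUpdate_of_forall_one (w : PMF I) : bayesUpdate w (fun _ => 1) = w := by
  ext i
  simpa using bayesUpdate_mul (w := w) (L := fun _ => 1) (fun _ => le_rfl) i

end BayesRule

/-! ### The joint posterior as a Bayesian mixture -/

section Model

variable {A O : Type*} {R : Set ℝ}

theorem prod_length_append_singleton {S : Type*} (F : List S → S → ℝ≥0∞) (h : List S) (s : S) :
    ∏ k : Fin (h ++ [s]).length, F ((h ++ [s]).take k) ((h ++ [s]).get k) =
      (∏ k : Fin h.length, F (h.take k) (h.get k)) * F h s := by
  have e : h.length + 1 = (h ++ [s]).length := by simp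
  rw [← Fintype.prod_equiv (finCongr e)
    (fun k => F ((h ++ [s]).take k) ((h ++ [s]).get (Fin.cast e k))) _ (fun k => rfl),
    Fin.prod_univ_castSucc]
  congr 1
  · refine Finset.prod_congr rfl fun k _ => ?_
    have hk : (k : ℕ) ≤ h.length := k.2.le
    simp [List.take_append_of_le_length hk]
  · simp

theorem envLikelihood_append (ν : Environment A O R) (h : List (Interaction A O R))
    (s : Interaction A O R) :
    envLikelihood ν (h ++ [s]) = envLikelihood ν h * ν h s.1 s.2 :=
  prod_length_append_singleton (fun g s => ν g s.1 s.2) h s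

theorem policyLikelihood_append (π : Policy A O R) (h : List (EInteraction A O R))
    (s : EInteraction A O R) :
    policyLikelihood π (h ++ [s]) =
      policyLikelihood π h * if s.1 then π (forget h) s.2.1 else 1 :=
  prod_length_append_singleton
    (fun (g : List (EInteraction A O R)) s => if s.1 then π (forget g) s.2.1 else 1) h s

theorem envLikelihood_le_one (ν : Environment A O R) (h : List (Interaction A O R)) :
    envLikelihood ν h ≤ 1 :=
  Finset.prod_le_one' fun _ _ => PMF.coe_le_one _ _

theorem policyLikelihood_le_one (π : Policy A O R) (h : List (EInteraction A O R)) :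
    policyLikelihood π h ≤ 1 :=
  Finset.prod_le_one' fun k _ => by
    split_ifs
    · exact PMF.coe_le_one _ _
    · exact le_rfl

theorem forget_append (h : List (EInteraction A O R)) (s : EInteraction A O R) :
    forget (h ++ [s]) = forget h ++ [s.2] := by
  simp [forget]

theorem eInteract_apply (c : List (EInteraction A O R) → PMF (Bool × A)) (ν : Environment A O R)
    (h : List (EInteraction A O R)) (s : EInteraction A O R) :
    eInteract c ν h s = c h (s.1, s.2.1) * ν (forget h) s.2.1 s.2.2 := by
  obtain ⟨e, a, x⟩ := s
  rw [eInteract, PMF.bind_apply, tsum_eq_single (e, a), PMF.map_apply, tsum_eq_single x]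
  · simp
  · intro y hy
    simp [hy.symm]
  · rintro ⟨e', a'⟩ hb
    rw [PMF.map_apply, ENNReal.tsum_eq_zero.2, mul_zero]
    intro y
    rw [if_neg]
    rintro heq
    exact hb (by simp_all)

theorem map_snd_eInteract (c : List (EInteraction A O R) → PMF (Bool × A)) (ν : Environment A O R)
    (h : List (EInteraction A O R)) :
    (eInteract c ν h).map Prod.snd =
      ((c h).map Prod.snd).bind fun a => (ν (forget h) a).map fun x => (a, x) := by
  rw [eInteract, PMF.map_bind, PMF.bind_map]
  simp only [PMF.map_comp]
  rfl

/-- One step in which the exploration indicator is drawn with probability `b`, and the action from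
`π` or `πs` accordingly. -/
def mixedStep (b : List (EInteraction A O R) → ℝ≥0∞) (hb : ∀ h, b h ≤ 1) (πs : Policy A O R)
    (π : List (EInteraction A O R) → PMF A) (ν : Environment A O R) :
    List (EInteraction A O R) → PMF (EInteraction A O R) :=
  eInteract (fun h => (coin (b h) (hb h)).bind fun e =>
    (if e then π h else πs (forget h)).map fun a => (e, a)) ν

variable {b : List (EInteraction A O R) → ℝ≥0∞} {hb : ∀ h, b h ≤ 1} {πs : Policy A O R}
  {π : List (EInteraction A O R) → PMF A} {ν : Environment A O R}

theorem map_prodMk_apply (p : PMF A) (e e' : Bool) (a : A) :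
    (p.map fun a => (e', a)) (e, a) = if e = e' then p a else 0 := by
  rw [PMF.map_apply]
  split_ifs with h
  · subst h
    rw [tsum_eq_single a]
    · simp
    · intro y hy
      simp [hy.symm]
  · simp [h]

theorem mixedStep_apply (h : List (EInteraction A O R)) (s : EInteraction A O R) :
    mixedStep b hb πs π ν h s =
      (if s.1 then b h * π h s.2.1 else (1 - b h) * πs (forget h) s.2.1) *
        ν (forget h) s.2.1 s.2.2 := by
  rw [mixedStep, eInteract_apply, PMF.bind_apply, tsum_fintype]
  simp only [map_prodMk_apply, coin, PMF.ofFintype_apply, Fintype.sum_bool]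
  obtain ⟨e, a, x⟩ := s
  cases e <;> simp

theorem map_snd_mixedStep_one (h : List (EInteraction A O R)) (p : Policy A O R) :
    (mixedStep (fun _ => 1) (fun _ => le_rfl) πs (fun h => p (forget h)) ν h).map Prod.snd =
      interact p ν (forget h) := by
  have hc : coin 1 le_rfl = PMF.pure true := by
    ext e; cases e <;> simp [coin]
  rw [mixedStep, map_snd_eInteract, hc, PMF.pure_bind, PMF.map_comp]
  simp only [Function.comp_def, if_true]
  rw [← Function.id_def, PMF.map_id]
  rfl

theorem map_snd_mixedStep_zero (h : List (EInteraction A O R)) :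
    (mixedStep (fun _ => 0) (fun _ => zero_le) πs π ν h).map Prod.snd =
      interact πs ν (forget h) := by
  have hc : coin 0 zero_le = PMF.pure false := by
    ext e; cases e <;> simp [coin]
  rw [mixedStep, map_snd_eInteract, hc, PMF.pure_bind, PMF.map_comp]
  simp only [Function.comp_def, Bool.false_eq_true, if_false]
  rw [← Function.id_def, PMF.map_id]
  rfl

theorem eInteract_true_eq_mixedStep :
    eInteract (fun h => (π h).map fun a => (true, a)) ν =
      mixedStep (fun _ => 1) (fun _ => le_rfl) πs π ν := by
  funext h
  ext ⟨e, a, x⟩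
  rw [mixedStep_apply, eInteract_apply, map_prodMk_apply]
  cases e <;> simp

variable {M : Set (Environment A O R)} {P : Set (Policy A O R)}

/-- The histories that have positive probability under the mixtures. -/
def Possible (wM : PMF M) (wP : PMF P) (h : List (EInteraction A O R)) : Prop :=
  ∑' ν, wM ν * envLikelihood ν.1 (forget h) ≠ 0 ∧ ∑' π, wP π * policyLikelihood π.1 h ≠ 0

/-- The joint posterior weights. -/
def posteriorWeight (wM : PMF M) (wP : PMF P) (h : List (EInteraction A O R)) (p : M × P) : ℝ≥0∞ :=
  envPosterior wM (forget h) p.1 * policyPosterior wP h p.2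

theorem toReal_posteriorWeight (wM : PMF M) (wP : PMF P) (h : List (EInteraction A O R))
    (p : M × P) :
    (posteriorWeight wM wP h p).toReal = jointPosterior wM wP h p :=
  ENNReal.toReal_mul

theorem tsum_posteriorWeight (wM : PMF M) (wP : PMF P) (h : List (EInteraction A O R)) :
    ∑' p, posteriorWeight wM wP h p = 1 := by
  rw [ENNReal.tsum_prod']
  simp only [posteriorWeight, ENNReal.tsum_mul_left, PMF.tsum_coe, mul_one]

theorem posteriorWeight_nil (wM : PMF M) (wP : PMF P) (p : M × P) :
    posteriorWeight wM wP [] p = wM p.1 * wP p.2 := by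
  have h1 : (fun ν : M => envLikelihood ν.1 (forget ([] : List (EInteraction A O R)))) =
      fun _ => 1 := rfl
  have h2 : (fun π : P => policyLikelihood π.1 []) = fun _ => 1 := rfl
  rw [posteriorWeight, envPosterior, policyPosterior, h1, h2, bayesUpdate_of_forall_one,
    bayesUpdate_of_forall_one]

theorem possible_nil (wM : PMF M) (wP : PMF P) : Possible wM wP [] := by
  have h1 (ν : M) : envLikelihood ν.1 (forget ([] : List (EInteraction A O R))) = 1 := rfl
  have h2 (π : P) : policyLikelihood π.1 [] = 1 := rfl
  simp only [Possible, h1, h2, mul_one, PMF.tsum_coe]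
  simp

/-- The factors `b`, `1 - b` and `πs` are common to all hypotheses and cancel; a step with `e = 0`
leaves the policy posterior alone. Hence one family of weights serves Mentee and pure exploration
alike. -/
theorem isBayesMixture (wM : PMF M) (wP : PMF P) (b : List (EInteraction A O R) → ℝ≥0∞)
    (hb : ∀ h, b h ≤ 1) (πs : Policy A O R) :
    IsBayesMixture (Possible wM wP) (posteriorWeight wM wP)
      (fun p => mixedStep b hb πs (fun h => p.2.1 (forget h)) p.1.1)
      (mixedStep b hb πs (mixturePolicy wP) (mixtureEnv wM)) where
  le_one h i := mul_le_one' (PMF.coe_le_one _ _) (PMF.coe_le_one _ _)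
  good_append h s hh hs := by
    rw [mixedStep_apply] at hs
    obtain ⟨hs1, hs2⟩ := mul_ne_zero_iff.1 hs
    constructor
    · simp only [forget_append, envLikelihood_append]
      rw [← tsum_bayesUpdate_mul fun ν : M => envLikelihood_le_one ν.1 (forget h)]
      rw [mixtureEnv, PMF.bind_apply] at hs2
      exact mul_ne_zero hh.1 hs2
    · simp only [policyLikelihood_append]
      rw [← tsum_bayesUpdate_mul fun π : P => policyLikelihood_le_one π.1 h]
      refine mul_ne_zero hh.2 ?_
      cases hs0 : s.1
      · simp [PMF.tsum_coe]
      · simp only [hs0, if_true] at hs1 ⊢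
        have := right_ne_zero_of_mul hs1
        rwa [mixturePolicy, PMF.bind_apply] at this
  update h s i hh := by
    have h1 : envPosterior wM (forget (h ++ [s])) i.1 * mixtureEnv wM (forget h) s.2.1 s.2.2 =
        envPosterior wM (forget h) i.1 * i.1.1 (forget h) s.2.1 s.2.2 := by
      rw [mixtureEnv, PMF.bind_apply, forget_append, envPosterior]
      simp only [envLikelihood_append]
      exact bayesUpdate_step (fun ν : M => envLikelihood_le_one ν.1 (forget h))
        (fun ν : M => PMF.coe_le_one _ _) hh.1 i.1
    have h2 := bayesUpdate_step (w := wP) (fun π : P => policyLikelihood_le_one π.1 h)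
      (ℓ := fun π : P => if s.1 then π.1 (forget h) s.2.1 else 1)
      (fun π : P => by split_ifs; exacts [PMF.coe_le_one _ _, le_rfl]) hh.2 i.2
    simp only [← policyLikelihood_append] at h2
    change policyPosterior wP (h ++ [s]) i.2 * (∑' π, policyPosterior wP h π * _) =
      policyPosterior wP h i.2 * _ at h2
    rw [mixedStep_apply, mixedStep_apply, posteriorWeight, posteriorWeight]
    cases hs0 : s.1
    · simp only [hs0, Bool.false_eq_true, if_false, mul_one, PMF.tsum_coe] at h2 ⊢
      rw [h2]
      calc _ = (envPosterior wM (forget (h ++ [s])) i.1 * mixtureEnv wM (forget h) s.2.1 s.2.2) *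
            (policyPosterior wP h i.2 * ((1 - b h) * πs (forget h) s.2.1)) := by ring
        _ = _ := by rw [h1]; ring
    · simp only [hs0, if_true] at h2 ⊢
      rw [← PMF.bind_apply (policyPosterior wP h) (fun π : P => π.1 (forget h)) s.2.1] at h2
      change _ * mixturePolicy wP h s.2.1 = _ at h2
      calc _ = (envPosterior wM (forget (h ++ [s])) i.1 * mixtureEnv wM (forget h) s.2.1 s.2.2) *
            (policyPosterior wP (h ++ [s]) i.2 * mixturePolicy wP h s.2.1) * b h := by ring
        _ = _ := by rw [h1, h2]; ring

end Model

/-! ### Information gain and exploration -/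

section KL

/-- Domination by `C` makes the logarithmic series summable, so its real `tsum` is not the default
value 0. The corrections `- w' + w` then cancel, both families having total mass one. -/
theorem ofReal_tsum_mul_log {I : Type*} {w w' : I → ℝ≥0∞} (hw : ∑' i, w i = 1)
    (hw' : ∑' i, w' i = 1) {C : ℝ≥0} (hC : ∀ i, w' i ≤ C * w i) :
    ENNReal.ofReal (∑' i, (w' i).toReal * Real.log ((w' i).toReal / (w i).toReal)) =
      ∑' i, klTerm (w' i) (w i) := by
  have ne {v : I → ℝ≥0∞} (hv : ∑' i, v i = 1) (i : I) : v i ≠ ∞ :=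
    ne_top_of_le_ne_top ENNReal.one_ne_top ((ENNReal.le_tsum i).trans_eq hv)
  have sm {v : I → ℝ≥0∞} (hv : ∑' i, v i = 1) : Summable fun i => (v i).toReal :=
    ENNReal.summable_toReal (by simp [hv])
  have ts {v : I → ℝ≥0∞} (hv : ∑' i, v i = 1) : ∑' i, (v i).toReal = 1 := by
    rw [← ENNReal.tsum_toReal_eq (ne hv), hv, ENNReal.toReal_one]
  have nonneg (i : I) := klReal_nonneg (ENNReal.toReal_nonneg (a := w' i))
    (ENNReal.toReal_nonneg (a := w i)) (toReal_eq_zero_imp (ne hw i) fun e => by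
      simpa [e] using hC i)
  have bound (i : I) : (w' i).toReal * Real.log ((w' i).toReal / (w i).toReal) - (w' i).toReal +
      (w i).toReal ≤ (w' i).toReal * Real.log (max C 1 : ℝ≥0) + (w i).toReal := by
    have h0 : 0 ≤ (w' i).toReal := ENNReal.toReal_nonneg
    have : (w' i).toReal * Real.log ((w' i).toReal / (w i).toReal) ≤
        (w' i).toReal * Real.log (max C 1 : ℝ≥0) := by
      rcases h0.eq_or_lt with e | hpos
      · simp [← e]
      have hC' : (w' i).toReal ≤ C * (w i).toReal := by
        have := ENNReal.toReal_mono (ENNReal.mul_ne_top ENNReal.coe_ne_top (ne hw i)) (hC i)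
        simpa using this
      have hwpos : 0 < (w i).toReal := by
        by_contra hcon
        have : (w i).toReal = 0 := le_antisymm (not_lt.1 hcon) ENNReal.toReal_nonneg
        rw [this, mul_zero] at hC'
        linarith
      gcongr
      · rw [div_le_iff₀ hwpos]
        refine hC'.trans ?_
        gcongr
        exact_mod_cast le_max_left C 1
    linarith
  have hs : Summable fun i => (w' i).toReal * Real.log ((w' i).toReal / (w i).toReal) -
      (w' i).toReal + (w i).toReal :=
    Summable.of_nonneg_of_le nonneg bound (((sm hw').mul_right _).add (sm hw))
  simp only [klTerm]
  rw [← ENNReal.ofReal_tsum_of_nonneg nonneg hs]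
  have h1 : Summable fun i => (w' i).toReal * Real.log ((w' i).toReal / (w i).toReal) := by
    refine ((hs.add (sm hw')).sub (sm hw)).congr fun i => ?_
    ring
  rw [Summable.tsum_add (h1.sub (sm hw')) (sm hw), Summable.tsum_sub h1 (sm hw'), ts hw, ts hw']
  simp

theorem mul_surprisal (v : ℝ≥0∞) (hv : v ≤ 1) :
    v * surprisal v = ENNReal.ofReal (Real.negMulLog v.toReal) := by
  have hv' : v ≠ ∞ := ne_top_of_le_ne_top ENNReal.one_ne_top hv
  nth_rw 1 [← ENNReal.ofReal_toReal hv']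
  rw [surprisal, ← ENNReal.ofReal_mul ENNReal.toReal_nonneg, Real.negMulLog]
  congr 1
  ring

theorem FiniteEntropy.tsum_ne_top {I : Type*} {w : PMF I} (hw : FiniteEntropy w) :
    ∑' i, w i * surprisal (w i) ≠ ∞ := by
  simp only [mul_surprisal _ (w.coe_le_one _)]
  exact Summable.tsum_ofReal_ne_top hw

theorem mul_surprisal_mul_le (a b : ℝ≥0∞) (ha : a ≤ 1) (hb : b ≤ 1) :
    a * b * surprisal (a * b) ≤ b * (a * surprisal a) + a * (b * surprisal b) := by
  rcases eq_or_ne a 0 with rfl | ha0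
  · simp
  rcases eq_or_ne b 0 with rfl | hb0
  · simp
  have hat : a.toReal ≠ 0 :=
    ENNReal.toReal_ne_zero.2 ⟨ha0, ne_top_of_le_ne_top ENNReal.one_ne_top ha⟩
  have hbt : b.toReal ≠ 0 :=
    ENNReal.toReal_ne_zero.2 ⟨hb0, ne_top_of_le_ne_top ENNReal.one_ne_top hb⟩
  calc a * b * surprisal (a * b) ≤ a * b * (surprisal a + surprisal b) := by
        gcongr
        rw [surprisal, ENNReal.toReal_mul, Real.log_mul hat hbt, neg_add]
        exact ENNReal.ofReal_add_le
    _ = _ := by ring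

/-- The joint prior is a product, so its entropy is bounded by the sum of the two entropies. -/
theorem tsum_posteriorWeight_nil_mul_surprisal_ne_top {A O : Type*} {R : Set ℝ}
    {M : Set (Environment A O R)} {P : Set (Policy A O R)} {wM : PMF M} {wP : PMF P}
    (hwM : FiniteEntropy wM) (hwP : FiniteEntropy wP) :
    ∑' i, posteriorWeight wM wP [] i * surprisal (posteriorWeight wM wP [] i) ≠ ∞ := by
  simp only [posteriorWeight_nil]
  refine ne_top_of_le_ne_top (ENNReal.add_ne_top.2 ⟨hwM.tsum_ne_top, hwP.tsum_ne_top⟩) ?_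
  calc _ ≤ ∑' i : M × P, (wP i.2 * (wM i.1 * surprisal (wM i.1)) +
        wM i.1 * (wP i.2 * surprisal (wP i.2))) :=
      ENNReal.tsum_le_tsum fun i => mul_surprisal_mul_le _ _ (wM.coe_le_one _) (wP.coe_le_one _)
    _ = _ := by
      rw [ENNReal.tsum_add, ENNReal.tsum_prod', ENNReal.tsum_prod']
      simp only [ENNReal.tsum_mul_right, ENNReal.tsum_mul_left, PMF.tsum_coe, one_mul]

end KL

/-! ### Information revealed by partial exploration -/

section Exploration

variable {A O : Type*} {R : Set ℝ} {b : List (EInteraction A O R) → ℝ≥0∞} {hb : ∀ h, b h ≤ 1}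
  {πs : Policy A O R} {π π' : List (EInteraction A O R) → PMF A} {ν ν' : Environment A O R}

/-- A step that always explores. -/
abbrev exploreStep (πs : Policy A O R) (π : List (EInteraction A O R) → PMF A)
    (ν : Environment A O R) : List (EInteraction A O R) → PMF (EInteraction A O R) :=
  mixedStep (fun _ => 1) (fun _ => le_rfl) πs π ν

theorem mixedStep_true (h : List (EInteraction A O R)) (s : Interaction A O R) :
    mixedStep b hb πs π ν h (true, s) = b h * exploreStep πs π ν h (true, s) := by
  simp [mixedStep_apply, mul_assoc]

theorem exploreStep_false (h : List (EInteraction A O R)) (s : Interaction A O R) :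
    exploreStep πs π ν h (false, s) = 0 := by
  simp [mixedStep_apply]

theorem mul_exploreStep_le (h : List (EInteraction A O R)) (s : EInteraction A O R) :
    b h * exploreStep πs π ν h s ≤ mixedStep b hb πs π ν h s := by
  obtain ⟨e, s⟩ := s
  cases e
  · simp [exploreStep_false]
  · exact (mixedStep_true h s).ge

theorem mul_expectStep_exploreStep_le (f : List (EInteraction A O R) → ℝ≥0∞)
    (h : List (EInteraction A O R)) :
    b h * expectStep (exploreStep πs π ν) f h ≤ expectStep (mixedStep b hb πs π ν) f h := by
  rw [expectStep, expectStep, ← ENNReal.tsum_mul_left]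
  refine ENNReal.tsum_le_tsum fun s => ?_
  rw [← mul_assoc]
  gcongr
  exact mul_exploreStep_le h s

/-- Exploratory outcomes occur in the mixed step with the extra factor `b h`, and `klTerm` is
homogeneous; the outcomes with `e = 0` only add nonnegative terms. -/
theorem mul_stepKL_exploreStep_le (h : List (EInteraction A O R)) :
    b h * stepKL (exploreStep πs π ν) (exploreStep πs π' ν') h ≤
      stepKL (mixedStep b hb πs π ν) (mixedStep b hb πs π' ν') h := by
  rw [stepKL, stepKL, ← ENNReal.tsum_mul_left]
  refine ENNReal.tsum_le_tsum fun s => ?_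
  obtain ⟨e, s⟩ := s
  cases e
  · simp [exploreStep_false]
  · rw [mixedStep_true (b := b), mixedStep_true (b := b), klTerm_mul,
      ENNReal.ofReal_toReal (ne_top_of_le_ne_top ENNReal.one_ne_top (hb h))]

/-- One factor `p` for each of the `j` steps leading to the history, and one for the step whose
entropy is measured. -/
theorem pow_mul_expect_stepKL_le {p : ℝ≥0∞} (j : ℕ) (h : List (EInteraction A O R))
    (hp : ∀ l : List (EInteraction A O R), l.length ≤ j → p ≤ b (h ++ l)) :
    p ^ (j + 1) * expect (exploreStep πs π ν) j
        (stepKL (exploreStep πs π ν) (exploreStep πs π' ν')) h ≤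
      expect (mixedStep b hb πs π ν) j
        (stepKL (mixedStep b hb πs π ν) (mixedStep b hb πs π' ν')) h := by
  have hp0 : p ≤ b h := by simpa using hp [] (by simp)
  induction j generalizing h with
  | zero =>
    refine le_trans ?_ (mul_stepKL_exploreStep_le h)
    rw [zero_add, pow_one, expect_zero]
    gcongr
  | succ j ih =>
    rw [expect_succ, expect_succ]
    refine le_trans ?_ (mul_expectStep_exploreStep_le _ h)
    rw [pow_succ', mul_assoc]
    gcongr
    rw [expectStep, expectStep, ← ENNReal.tsum_mul_left]
    refine ENNReal.tsum_le_tsum fun s => ?_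
    rw [mul_left_comm]
    gcongr
    refine ih _ (fun l hl => ?_) ?_
    · simpa using hp (s :: l) (by simpa using hl)
    · exact hp [s] (by simp)

/-- If the next `n` steps explore with probability at least `p`, then they reveal at least the
fraction `p ^ n` of what `n` exploratory steps would reveal. -/
theorem pow_mul_pathKL_le {p : ℝ≥0∞} (n : ℕ) (h : List (EInteraction A O R))
    (hp : ∀ l : List (EInteraction A O R), l.length < n → p ≤ b (h ++ l)) :
    p ^ n * pathKL (exploreStep πs π ν) (exploreStep πs π' ν') n h ≤
      pathKL (mixedStep b hb πs π ν) (mixedStep b hb πs π' ν') n h := by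
  rw [pathKL, pathKL, Finset.mul_sum]
  refine Finset.sum_le_sum fun j hj => ?_
  have hj' := Finset.mem_range.1 hj
  refine le_trans ?_ (pow_mul_expect_stepKL_le j h fun l hl => hp l (hl.trans_lt hj'))
  gcongr ?_ * _
  exact pow_le_pow_right_of_le_one' ((hp [] (by simp; omega)).trans (hb _)) hj'

end Exploration

/-! ### Mentee's information gain and the decay of exploration -/

section Mentee

variable {A O : Type*} {R : Set ℝ} {M : Set (Environment A O R)} {P : Set (Policy A O R)}
  [Countable A] [MeasurableSpace A] [DiscreteMeasurableSpace A]
  [Countable O] [MeasurableSpace O] [DiscreteMeasurableSpace O] [Countable R]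
  {wM : PMF M} {wP : PMF P} {η : ℝ}

/-- Two forms of mutual information: expected divergence of posterior from prior, and average
divergence of the components from their mixture. `πs` is arbitrary because it is never used when
every step explores. -/
theorem infoGainValue_eq (πs : Policy A O R) (m : ℕ) {h : List (EInteraction A O R)}
    (hh : Possible wM wP h) :
    infoGainValue wM wP m h = ∑' i, posteriorWeight wM wP h i *
      pathKL (exploreStep πs (fun h => i.2.1 (forget h)) i.1.1)
        (exploreStep πs (mixturePolicy wP) (mixtureEnv wM)) m h := by
  have B := isBayesMixture wM wP (fun _ => 1) (fun _ => le_rfl) πs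
  rw [← B.expect_tsum_klTerm m hh, infoGainValue, eInteract_true_eq_mixedStep (πs := πs)]
  simp only [infoGain]
  rw [lintegral_continuationLaw _ h m (fun g => ENNReal.ofReal (∑' p,
    jointPosterior wM wP g p * Real.log (jointPosterior wM wP g p / jointPosterior wM wP h p)))]
  -- The domination constant `C`, needed for summability of the logarithmic series, travels along
  -- the path; each step divides it by the predictive probability.
  refine expect_congr_of_closed (G := fun g => Possible wM wP g ∧
    ∃ C : ℝ≥0, ∀ i, posteriorWeight wM wP g i ≤ C * posteriorWeight wM wP h i) ?_ m ?_ h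
    ⟨hh, 1, fun i => by simp⟩
  · rintro g s ⟨hg, C, hC⟩ hs
    refine ⟨B.good_append g s hg hs, ?_⟩
    set q := mixedStep (fun _ => 1) (fun _ => le_rfl) πs (mixturePolicy wP) (mixtureEnv wM) g s
    have hq : q ≠ ∞ := PMF.apply_ne_top _ _
    refine ⟨C * q⁻¹.toNNReal, fun i => ?_⟩
    rw [ENNReal.coe_mul, ENNReal.coe_toNNReal (ENNReal.inv_ne_top.2 hs), mul_right_comm,
      ← div_eq_mul_inv, ENNReal.le_div_iff_mul_le (Or.inl hs) (Or.inl hq), B.update g s i hg]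
    exact (mul_le_of_le_one_right' (PMF.coe_le_one _ _)).trans (hC i)
  · rintro g ⟨hg, C, hC⟩
    simp only [← toReal_posteriorWeight]
    exact ofReal_tsum_mul_log (tsum_posteriorWeight wM wP h) (tsum_posteriorWeight wM wP g) hC

theorem menteeStep_eq (πh πs : Policy A O R) (ν : Environment A O R) :
    menteeStep wM wP η πh πs ν = mixedStep (explorationProb wM wP η)
      (explorationProb_le_one wM wP η) πs (fun h => πh (forget h)) ν := by
  have : menteeChoice wM wP η πh πs = fun h => (coin (explorationProb wM wP η h)
      (explorationProb_le_one wM wP η h)).bind fun e =>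
        (if e then πh (forget h) else πs (forget h)).map fun a => (e, a) := by
    funext h
    simp only [menteeChoice, ite_apply]
  rw [menteeStep, this, mixedStep]

/-- The truncated contribution of `V^IG_{m,0}` to the exploration probability. -/
def explorationTerm (wM : PMF M) (wP : PMF P) (η : ℝ) (m : ℕ) (h : List (EInteraction A O R)) :
    ℝ≥0∞ :=
  min 1 (ENNReal.ofReal (η / m) * infoGainValue wM wP m h)

/-- The weight of `V^IG_{m,k}` in the exploration probability. -/
def explorationWeight (m : ℕ) : ℝ≥0∞ := ENNReal.ofReal (1 / ((m : ℝ) ^ 2 * (m + 1)))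

theorem explorationProb_eq (h : List (EInteraction A O R)) :
    explorationProb wM wP η h = ∑' m : ℕ, ∑ k ∈ Finset.range (min m (h.length + 1)),
      explorationWeight m * explorationTerm wM wP η m (h.take (h.length - k)) := rfl

/-- The summand with delay `k = l.length` looks back exactly to `h`. Thus a large information value
at `h` keeps exploration likely throughout the next `m` steps. -/
theorem le_explorationProb (m : ℕ) (h l : List (EInteraction A O R)) (hl : l.length < m) :
    explorationWeight m * explorationTerm wM wP η m h ≤ explorationProb wM wP η (h ++ l) := by
  rw [explorationProb_eq]
  refine le_trans ?_ (ENNReal.le_tsum m)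
  have hmem : l.length ∈ Finset.range (min m ((h ++ l).length + 1)) := by
    rw [Finset.mem_range, lt_min_iff, List.length_append]
    omega
  refine le_of_eq_of_le ?_ (Finset.single_le_sum (fun _ _ => zero_le) hmem)
  simp

/-- Mentee's interaction when mentor and environment are drawn from the prior. -/
abbrev mixtureStep (wM : PMF M) (wP : PMF P) (η : ℝ) (πs : Policy A O R) :
    List (EInteraction A O R) → PMF (EInteraction A O R) :=
  mixedStep (explorationProb wM wP η) (explorationProb_le_one wM wP η) πs (mixturePolicy wP)
    (mixtureEnv wM)

theorem isBayesMixture_mentee (wM : PMF M) (wP : PMF P) (η : ℝ) (πs : Policy A O R) :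
    IsBayesMixture (Possible wM wP) (posteriorWeight wM wP)
      (fun p => menteeStep wM wP η p.2.1 πs p.1.1) (mixtureStep wM wP η πs) := by
  simp only [menteeStep_eq]
  exact isBayesMixture wM wP _ _ πs

theorem pow_mul_infoGainValue_le (πs : Policy A O R) (m : ℕ) {h : List (EInteraction A O R)}
    (hh : Possible wM wP h) :
    (explorationWeight m * explorationTerm wM wP η m h) ^ m * infoGainValue wM wP m h ≤
      ∑' i, posteriorWeight wM wP h i *
        pathKL (menteeStep wM wP η i.2.1 πs i.1.1) (mixtureStep wM wP η πs) m h := by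
  rw [infoGainValue_eq πs m hh, ← ENNReal.tsum_mul_left]
  refine ENNReal.tsum_le_tsum fun i => ?_
  rw [mul_left_comm, menteeStep_eq]
  gcongr
  exact pow_mul_pathKL_le m h fun l hl => le_explorationProb m h l hl

theorem explorationTerm_le_one (m : ℕ) (h : List (EInteraction A O R)) :
    explorationTerm wM wP η m h ≤ 1 := min_le_left _ _

theorem explorationWeight_ne_zero {m : ℕ} (hm : m ≠ 0) : explorationWeight m ≠ 0 := by
  have : 0 < (m : ℝ) := by positivity
  exact (ENNReal.ofReal_pos.2 (by positivity)).ne'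

/-- One factor of the power is bounded by `η / m` times the information value; the other `m` pay for
`m` consecutive explorations. Mentee's information over windows of length `m` totals at most `m`
times the prior entropy. -/
theorem tsum_expect_explorationTerm_pow_ne_top (hwM : FiniteEntropy wM) (hwP : FiniteEntropy wP)
    (πs : Policy A O R) {m : ℕ} (hm : m ≠ 0) :
    ∑' t, expect (mixtureStep wM wP η πs) t
      (fun h => explorationTerm wM wP η m h ^ (m + 1)) [] ≠ ∞ := by
  have B := isBayesMixture_mentee wM wP η πs
  set c := explorationWeight m
  have hc0 : c ^ m ≠ 0 := pow_ne_zero _ (explorationWeight_ne_zero hm)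
  have hct : c ^ m ≠ ∞ := ENNReal.pow_ne_top ENNReal.ofReal_ne_top
  have bound : ∀ h, Possible wM wP h → explorationTerm wM wP η m h ^ (m + 1) ≤
      (ENNReal.ofReal (η / m) * (c ^ m)⁻¹) * ∑' i, posteriorWeight wM wP h i *
        pathKL (menteeStep wM wP η i.2.1 πs i.1.1) (mixtureStep wM wP η πs) m h := by
    intro h hh
    calc explorationTerm wM wP η m h ^ (m + 1)
        ≤ explorationTerm wM wP η m h ^ m * (ENNReal.ofReal (η / m) * infoGainValue wM wP m h) := by
          rw [pow_succ]
          gcongr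
          exact min_le_right _ _
      _ = (c ^ m)⁻¹ * c ^ m * (explorationTerm wM wP η m h ^ m *
            (ENNReal.ofReal (η / m) * infoGainValue wM wP m h)) := by
          rw [ENNReal.inv_mul_cancel hc0 hct, one_mul]
      _ = (ENNReal.ofReal (η / m) * (c ^ m)⁻¹) *
            ((c * explorationTerm wM wP η m h) ^ m * infoGainValue wM wP m h) := by ring
      _ ≤ _ := by
          gcongr
          exact pow_mul_infoGainValue_le πs m hh
  refine ne_top_of_le_ne_top ?_ (ENNReal.tsum_le_tsum fun t =>
    expect_le_of_closed B.good_append t bound [] (possible_nil wM wP))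
  simp only [expect_const_mul]
  rw [ENNReal.tsum_mul_left]
  refine ENNReal.mul_ne_top (ENNReal.mul_ne_top ENNReal.ofReal_ne_top (ENNReal.inv_ne_top.2 hc0)) ?_
  exact ne_top_of_le_ne_top (ENNReal.mul_ne_top (ENNReal.natCast_ne_top m)
    (tsum_posteriorWeight_nil_mul_surprisal_ne_top hwM hwP))
    (B.tsum_expect_tsum_pathKL_le m (possible_nil wM wP))

theorem tsum_explorationWeight_ne_top : ∑' m : ℕ, m * explorationWeight m ≠ ∞ := by
  refine ne_top_of_le_ne_top (Summable.tsum_ofReal_ne_top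
    (Real.summable_one_div_nat_pow.2 one_lt_two)) (ENNReal.tsum_le_tsum fun m => ?_)
  rw [explorationWeight, ← ENNReal.ofReal_natCast, ← ENNReal.ofReal_mul (Nat.cast_nonneg m)]
  refine ENNReal.ofReal_le_ofReal ?_
  rcases Nat.eq_zero_or_pos m with rfl | hm
  · simp
  · have : (0 : ℝ) < m := by exact_mod_cast hm
    rw [mul_one_div, div_le_div_iff₀ (by positivity) (by positivity)]
    nlinarith [sq_nonneg (m : ℝ)]

/-- The value of `y` at the history `k` steps ago, or zero if there were less than `k` steps. -/
def delayed {S : Type*} (k : ℕ) (y : List S → ℝ≥0∞) (h : List S) : ℝ≥0∞ :=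
  if k ≤ h.length then y (h.take (h.length - k)) else 0

/-- The first `k` terms vanish and the others are the original series shifted by `k`. -/
theorem tsum_expect_delayed {S : Type*} (K : List S → PMF S) (k : ℕ) (y : List S → ℝ≥0∞) :
    ∑' t, expect K t (delayed k y) [] = ∑' t, expect K t y [] := by
  rw [← ENNReal.summable.sum_add_tsum_nat_add' (f := fun t => expect K t (delayed k y) [])
    (k := k), Finset.sum_eq_zero, zero_add]
  · refine tsum_congr fun t => ?_
    rw [expect_add_steps]
    congr 1
    funext h
    rw [← expect_take (K := K) (y := y) k h]
    exact expect_congr_length k h fun g hg => if_pos (by omega)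
  · intro t ht
    rw [expect_congr_length (G := fun _ => 0) t [] fun g hg => ?_, expect_const]
    refine if_neg ?_
    have := Finset.mem_range.1 ht
    simp only [List.length_nil, zero_add] at hg
    omega

/-- `β` contains first powers, while only powers `m + 1` have summable expectations; a threshold `δ`
bridges the two. -/
theorem le_add_inv_pow_mul_pow {x δ : ℝ≥0∞} (hδ : δ ≠ 0) (hδ' : δ ≠ ∞) (m : ℕ) :
    x ≤ δ + (δ ^ m)⁻¹ * x ^ (m + 1) := by
  rcases le_total x δ with h | h
  · exact h.trans le_self_add
  · refine le_trans ?_ le_add_self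
    calc x = (δ ^ m)⁻¹ * δ ^ m * x := by
          rw [ENNReal.inv_mul_cancel (pow_ne_zero _ hδ) (ENNReal.pow_ne_top hδ'), one_mul]
      _ ≤ (δ ^ m)⁻¹ * x ^ m * x := by gcongr
      _ = _ := by rw [pow_succ, mul_assoc]

/-- The exploration probability is small, up to a term whose expectations are summable. -/
theorem tsum_expect_explorationProb_sub_ne_top (hwM : FiniteEntropy wM) (hwP : FiniteEntropy wP)
    (πs : Policy A O R) {ε : ℝ≥0∞} (hε : ε ≠ 0) :
    ∑' t, expect (mixtureStep wM wP η πs) t (fun h => explorationProb wM wP η h - ε) [] ≠ ∞ := by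
  wlog hεt : ε ≠ ∞ generalizing ε
  · rw [not_not.1 hεt]
    simp [expect_const]
  -- Each `m` enters `β` with at most `m` delays, hence the weight `m * explorationWeight m`. Half
  -- of `ε` pays for the tail beyond `N`, the other half for the thresholds `δ` below `N`.
  obtain ⟨N, hN⟩ : ∃ N : ℕ, ∑' m : ℕ, ((m + N : ℕ) : ℝ≥0∞) * explorationWeight (m + N) ≤ ε / 2 :=
    ((ENNReal.tendsto_sum_nat_add _ tsum_explorationWeight_ne_top).eventually_le_const
      (ENNReal.half_pos hε)).exists
  set C := ∑' m : ℕ, (m : ℝ≥0∞) * explorationWeight m with hC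
  have hCt : C + 1 ≠ ∞ := ENNReal.add_ne_top.2 ⟨tsum_explorationWeight_ne_top, ENNReal.one_ne_top⟩
  set δ := ε / 2 / (C + 1) with hδ
  have hδ0 : δ ≠ 0 := (ENNReal.div_pos (ENNReal.half_pos hε).ne' hCt).ne'
  have hδt : δ ≠ ∞ := (ENNReal.div_lt_top (ENNReal.div_lt_top hεt (by simp)).ne (by simp)).ne
  have hδC : δ * C ≤ ε / 2 := by
    calc δ * C ≤ δ * (C + 1) := by gcongr; exact le_self_add
      _ ≤ ε / 2 := ENNReal.mul_le_of_le_div le_rfl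
  let y (m : ℕ) (h : List (EInteraction A O R)) : ℝ≥0∞ := explorationTerm wM wP η m h ^ (m + 1)
  let D (h : List (EInteraction A O R)) : ℝ≥0∞ := ∑ m ∈ Finset.range N, ∑ k ∈ Finset.range m,
    explorationWeight m * (δ ^ m)⁻¹ * delayed k (y m) h
  have hD : ∀ h, explorationProb wM wP η h - ε ≤ D h := by
    intro h
    rw [tsub_le_iff_left, explorationProb_eq,
      ← ENNReal.summable.sum_add_tsum_nat_add' (k := N)]
    have tail : ∑' m : ℕ, ∑ k ∈ Finset.range (min (m + N) (h.length + 1)),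
        explorationWeight (m + N) * explorationTerm wM wP η (m + N) (h.take (h.length - k)) ≤
        ε / 2 := by
      refine le_trans (ENNReal.tsum_le_tsum fun m => ?_) hN
      refine (Finset.sum_le_sum fun k _ =>
        mul_le_of_le_one_right' (explorationTerm_le_one _ _)).trans ?_
      rw [Finset.sum_const, Finset.card_range, nsmul_eq_mul]
      gcongr
      exact min_le_left _ _
    have head : ∑ m ∈ Finset.range N, ∑ k ∈ Finset.range (min m (h.length + 1)),
        explorationWeight m * explorationTerm wM wP η m (h.take (h.length - k)) ≤
        ε / 2 + D h := by
      calc _ ≤ ∑ m ∈ Finset.range N, ∑ k ∈ Finset.range m, (explorationWeight m * δ +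
            explorationWeight m * (δ ^ m)⁻¹ * delayed k (y m) h) := by
            refine Finset.sum_le_sum fun m _ => ?_
            refine le_trans (Finset.sum_le_sum fun k hk => ?_)
              (Finset.sum_le_sum_of_subset (Finset.range_mono (min_le_left m (h.length + 1))))
            have hk' : k ≤ h.length := by
              have := (lt_min_iff.1 (Finset.mem_range.1 hk)).2
              omega
            rw [delayed, if_pos hk', mul_assoc, ← mul_add]
            gcongr
            exact le_add_inv_pow_mul_pow hδ0 hδt m
        _ = δ * (∑ m ∈ Finset.range N, m * explorationWeight m) + D h := by
            simp only [Finset.sum_add_distrib, Finset.sum_const, Finset.card_range, nsmul_eq_mul, D]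
            rw [Finset.mul_sum]
            congr 1
            exact Finset.sum_congr rfl fun m _ => by ring
        _ ≤ _ := by
            gcongr
            refine le_trans ?_ hδC
            gcongr
            exact ENNReal.sum_le_tsum _
    calc _ ≤ (ε / 2 + D h) + ε / 2 := add_le_add head tail
      _ = ε + D h := by
          rw [add_right_comm, ENNReal.add_halves]
  refine ne_top_of_le_ne_top ?_ (ENNReal.tsum_le_tsum fun t => expect_mono t hD [])
  simp only [D, expect_sum, expect_const_mul]
  rw [Summable.tsum_finsetSum fun _ _ => ENNReal.summable]
  refine (ENNReal.sum_lt_top.2 fun m _ => ?_).ne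
  rw [Summable.tsum_finsetSum fun _ _ => ENNReal.summable]
  refine ENNReal.sum_lt_top.2 fun k hk => ?_
  rw [ENNReal.tsum_mul_left, tsum_expect_delayed]
  have hm : m ≠ 0 := by
    have := Finset.mem_range.1 hk
    omega
  exact ENNReal.mul_lt_top (ENNReal.mul_lt_top ENNReal.ofReal_lt_top
    (ENNReal.inv_lt_top.2 (pos_iff_ne_zero.2 (pow_ne_zero m hδ0))))
    (lt_top_iff_ne_top.2 (tsum_expect_explorationTerm_pow_ne_top hwM hwP πs hm))

end Mentee

/-! ### Almost sure convergence -/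

section AlmostSure

variable {S : Type*} [Countable S] [MeasurableSpace S] [DiscreteMeasurableSpace S]

theorem lintegral_tsum_history (K : List S → PMF S) (f : List S → ℝ≥0∞) :
    ∫⁻ ω, ∑' t, f (history ω t) ∂continuationLaw K [] = ∑' t, expect K t f [] := by
  rw [lintegral_tsum fun t => (measurable_history t f).aemeasurable]
  exact tsum_congr fun t => lintegral_continuationLaw K [] t f

/-- The random series has finite expectation, so it converges almost surely and its terms tend to 0.
-/
theorem ae_tendsto_zero_of_tsum_expect {K : List S → PMF S} {f : List S → ℝ≥0∞}
    (hf : ∑' t, expect K t f [] ≠ ∞) :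
    ∀ᵐ ω ∂continuationLaw K [], Tendsto (fun t => f (history ω t)) atTop (nhds 0) := by
  rw [← lintegral_tsum_history] at hf
  filter_upwards [ae_lt_top (Measurable.tsum fun t => measurable_history t f) hf] with ω hω
  exact ENNReal.tendsto_atTop_zero_of_tsum_ne_top hω.ne

theorem take_history {S : Type*} (ω : ℕ → S) {k n : ℕ} (hk : k ≤ n) :
    (history ω n).take k = history ω k := by
  refine List.ext_getElem (by simp [history, hk]) fun i _ _ => ?_
  simp [history]

namespace IsBayesMixture

variable {I : Type*} {good : List S → Prop} {W : List S → I → ℝ≥0∞} {K : I → List S → PMF S}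
  {Q : List S → PMF S}

theorem ae_tendsto_zero (B : IsBayesMixture good W K Q)
    (hnil : good []) {i : I} (hi : W [] i ≠ 0) {f : List S → ℝ≥0∞}
    (hf : ∑' t, expect Q t f [] ≠ ∞) :
    ∀ᵐ ω ∂continuationLaw (K i) [], Tendsto (fun t => f (history ω t)) atTop (nhds 0) := by
  refine ae_tendsto_zero_of_tsum_expect (ne_top_of_le_ne_top ?_
    (ENNReal.tsum_le_tsum fun t => B.expect_le_inv_mul hnil hi f t))
  rw [ENNReal.tsum_mul_left]
  exact ENNReal.mul_ne_top (ENNReal.inv_ne_top.2 hi) hf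

theorem ae_eventually_good (B : IsBayesMixture good W K Q)
    (hnil : good []) {i : I} (hi : W [] i ≠ 0) :
    ∀ᵐ ω ∂continuationLaw (K i) [], ∀ᶠ t in atTop, good (history ω t) := by
  classical
  have hz : ∑' t, expect (K i) t (fun h => if good h then 0 else 1) [] ≠ ∞ := by
    have (t : ℕ) : expect (K i) t (fun h => if good h then (0 : ℝ≥0∞) else 1) [] = 0 := by
      rw [expect_congr_of_closed (G := fun g => good g ∧ W g i ≠ 0) (g := fun _ => 0)
        (fun g s hg hs => B.good_append_of_ne_zero hg hs) t (fun g hg => if_pos hg.1) []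
        ⟨hnil, hi⟩, expect_const]
    simp [this]
  filter_upwards [ae_tendsto_zero_of_tsum_expect hz] with ω hω
  filter_upwards [hω.eventually_lt_const zero_lt_one] with t ht
  by_contra hcon
  simp [hcon] at ht

/-- The posterior weight of the true process ever drops below `δ` only with small probability. -/
theorem measure_exists_lt_le (B : IsBayesMixture good W K Q)
    (hnil : good []) {i : I} (hi : W [] i ≠ 0) (δ : ℝ≥0∞) :
    continuationLaw (K i) [] {ω | ∃ t, W (history ω t) i < δ} ≤ (W [] i)⁻¹ * δ := by
  classical
  -- Indicator of the first passage below `δ`. It occurs at most once on each path, so its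
  -- expectations under `Q` add up to at most one.
  let f (h : List S) : ℝ≥0∞ :=
    if W h i < δ ∧ ∀ k < h.length, δ ≤ W (h.take k) i then 1 else 0
  have hf (ω : ℕ → S) (t : ℕ) : f (history ω t) =
      if W (history ω t) i < δ ∧ ∀ k < t, δ ≤ W (history ω k) i then 1 else 0 := by
    have hlen : (history ω t).length = t := by simp [history]
    simp only [f, hlen]
    congr 1
    refine propext (and_congr_right fun _ => forall₂_congr fun k hk => ?_)
    rw [take_history ω hk.le]
  have hQ : ∑' t, expect Q t f [] ≤ 1 := by
    rw [← lintegral_tsum_history]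
    refine (lintegral_mono (g := fun _ => 1) fun ω => ?_).trans (by simp)
    by_cases hex : ∃ t, f (history ω t) ≠ 0
    · obtain ⟨t, ht⟩ := hex
      change ∑' t, f (history ω t) ≤ 1
      rw [tsum_eq_single t]
      · rw [hf]
        split_ifs <;> simp
      · intro t' ht'
        rw [hf] at ht ⊢
        have ht := (ite_ne_right_iff.1 ht).1
        rw [if_neg]
        rintro ⟨h1, h2⟩
        rcases lt_or_gt_of_ne ht' with hlt | hlt
        · exact absurd h1 (not_lt.2 (ht.2 t' hlt))
        · exact absurd ht.1 (not_lt.2 (h2 t hlt))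
    · push Not at hex
      simp [hex]
  have hK : ∑' t, expect (K i) t f [] ≤ (W [] i)⁻¹ * δ := by
    have hit : W [] i ≠ ∞ := ne_top_of_le_ne_top ENNReal.one_ne_top (B.le_one _ i)
    calc ∑' t, expect (K i) t f [] ≤ ∑' t, (W [] i)⁻¹ * (δ * expect Q t f []) := by
          refine ENNReal.tsum_le_tsum fun t => ?_
          calc expect (K i) t f [] = (W [] i)⁻¹ * (W [] i * expect (K i) t f []) := by
                rw [← mul_assoc, ENNReal.inv_mul_cancel hi hit, one_mul]
            _ ≤ _ := by
                rw [← B.expect_mul i t f [] hnil, ← congrFun (expect_const_mul t δ) []]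
                gcongr
                -- At a first passage the posterior weight is below `δ`, so the change of measure
                -- costs only this factor.
                refine expect_mono t (fun g => ?_) []
                simp only [f]
                split_ifs with hg
                · simpa using hg.1.le
                · simp
      _ = (W [] i)⁻¹ * δ * ∑' t, expect Q t f [] := by
          rw [ENNReal.tsum_mul_left, ENNReal.tsum_mul_left, mul_assoc]
      _ ≤ (W [] i)⁻¹ * δ := mul_le_of_le_one_right' hQ
  refine le_trans ?_ hK
  rw [← lintegral_tsum_history]
  have hm : Measurable fun ω : ℕ → S => ∑' t, f (history ω t) :=
    Measurable.tsum fun t => measurable_history t f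
  refine le_trans (measure_mono fun ω hω => ?_)
    (by simpa using mul_meas_ge_le_lintegral hm 1)
  have hω : ∃ t, W (history ω t) i < δ := hω
  refine le_trans (le_of_eq ?_) (ENNReal.le_tsum (Nat.find hω))
  rw [hf, if_pos ⟨Nat.find_spec hω, fun k hk => not_lt.1 (Nat.find_min hω hk)⟩]

/-- The posterior weight of the true process stays away from zero. -/
theorem ae_exists_le (B : IsBayesMixture good W K Q) (hnil : good []) {i : I} (hi : W [] i ≠ 0) :
    ∀ᵐ ω ∂continuationLaw (K i) [], ∃ δ : ℝ≥0∞, δ ≠ 0 ∧ ∀ t, δ ≤ W (history ω t) i := by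
  have hit : W [] i ≠ ∞ := ne_top_of_le_ne_top ENNReal.one_ne_top (B.le_one _ i)
  rw [ae_iff]
  by_contra hne
  set bad := {ω : ℕ → S | ¬∃ δ : ℝ≥0∞, δ ≠ 0 ∧ ∀ t, δ ≤ W (history ω t) i}
  set r := continuationLaw (K i) [] bad
  -- The level `W [] i * (r / 2)` makes the maximal inequality read `r ≤ r / 2`, impossible for a
  -- finite `r ≠ 0`.
  have hr : r ≤ (W [] i)⁻¹ * (W [] i * (r / 2)) := by
    refine (measure_mono fun ω hω => ?_).trans (B.measure_exists_lt_le hnil hi _)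
    by_contra hcon
    refine hω ⟨W [] i * (r / 2), mul_ne_zero hi (ENNReal.half_pos hne).ne', fun t => ?_⟩
    exact not_lt.1 fun hlt => hcon ⟨t, hlt⟩
  rw [← mul_assoc, ENNReal.inv_mul_cancel hi hit, one_mul] at hr
  exact absurd (ENNReal.half_lt_self hne (measure_ne_top _ _)) (not_lt.2 hr)

end IsBayesMixture

end AlmostSure

/-! ### Values -/

section Value

variable {S : Type*}

/-- The reward of the last step of a history. -/
def lastReward (rew : S → ℝ) (h : List S) : ℝ≥0∞ :=
  h.getLast?.elim 0 fun s => ENNReal.ofReal (rew s)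

theorem lastReward_le_one {rew : S → ℝ} (hrew : ∀ s, rew s ≤ 1) (h : List S) :
    lastReward rew h ≤ 1 := by
  rw [lastReward]
  cases h.getLast? with
  | none => simp
  | some s => simpa using hrew s

theorem lastReward_map {S' : Type*} (p : S → S') (rew : S' → ℝ) (h : List S) :
    lastReward rew (h.map p) = lastReward (fun s => rew (p s)) h := by
  rw [lastReward, lastReward, List.getLast?_map]
  cases h.getLast? <;> rfl

/-- The normalised discount `γ_{t+k} / Γ_t`. -/
def discountWeight (γ : ℕ → ℝ) (t k : ℕ) : ℝ≥0∞ := ENNReal.ofReal (γ (t + k) / tailSum γ t)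

variable {γ : ℕ → ℝ}

theorem summable_tail (hs : Summable γ) (t : ℕ) : Summable fun k => γ (t + k) := by
  simpa only [add_comm t] using (summable_nat_add_iff t).2 hs

theorem tsum_discountWeight_add (hγ : ∀ t, 0 ≤ γ t) (hs : Summable γ) (t m : ℕ) :
    ∑' k, discountWeight γ t (k + m) = ENNReal.ofReal (tailSum γ (t + m) / tailSum γ t) := by
  have h0 : 0 ≤ tailSum γ t := tsum_nonneg fun k => hγ _
  have e (k : ℕ) : discountWeight γ t (k + m) =
      ENNReal.ofReal (γ (t + m + k) / tailSum γ t) := by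
    rw [discountWeight, add_comm k m, add_assoc]
  simp only [e]
  rw [← ENNReal.ofReal_tsum_of_nonneg (fun k => div_nonneg (hγ _) h0)
    ((summable_tail hs (t + m)).div_const _), tsum_div_const]
  rfl

theorem tsum_discountWeight (hγ : ∀ t, 0 ≤ γ t) (hs : Summable γ) (hΓ : ∀ t, 0 < tailSum γ t)
    (t : ℕ) : ∑' k, discountWeight γ t k = 1 := by
  have := tsum_discountWeight_add hγ hs t 0
  simpa [div_self (hΓ t).ne'] using this

variable [Countable S] [MeasurableSpace S] [DiscreteMeasurableSpace S]

/-- Replaces the integral over infinite paths by finite-step expectations. The reward with discount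
index `k` is the last one after `k + 1` steps. -/
theorem ofReal_value (hγ : ∀ t, 0 ≤ γ t) (hs : Summable γ) (hΓ : ∀ t, 0 < tailSum γ t)
    {rew : S → ℝ} (hrew0 : ∀ s, 0 ≤ rew s) (hrew : ∀ s, rew s ≤ 1) (K : List S → PMF S)
    (h : List S) :
    ENNReal.ofReal (value γ rew K h) =
      ∑' k, discountWeight γ h.length k * expect K (k + 1) (lastReward rew) h := by
  have hsm (ω : ℕ → S) : Summable fun k => γ (h.length + k) * rew (ω k) :=
    Summable.of_nonneg_of_le (fun k => mul_nonneg (hγ _) (hrew0 _))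
      (fun k => mul_le_of_le_one_right (hγ _) (hrew _)) (summable_tail hs h.length)
  let G (ω : ℕ → S) : ℝ≥0∞ := ∑' k, ENNReal.ofReal (γ (h.length + k) * rew (ω k))
  have hterm (k : ℕ) : Measurable fun ω : ℕ → S =>
      ENNReal.ofReal (γ (h.length + k) * rew (ω k)) :=
    (Measurable.of_discrete (f := fun s : S => ENNReal.ofReal (γ (h.length + k) * rew s))).comp
      (measurable_pi_apply k)
  have hG : Measurable G := Measurable.tsum hterm
  have hGt (ω : ℕ → S) : G ω < ∞ := lt_top_iff_ne_top.2 (Summable.tsum_ofReal_ne_top (hsm ω))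
  have e1 (ω : ℕ → S) : ∑' k, γ (h.length + k) * rew (ω k) = (G ω).toReal := by
    simp only [G]
    rw [← ENNReal.ofReal_tsum_of_nonneg (fun k => mul_nonneg (hγ _) (hrew0 _)) (hsm ω),
      ENNReal.toReal_ofReal (tsum_nonneg fun k => mul_nonneg (hγ _) (hrew0 _))]
  have e2 : ∫⁻ ω, G ω ∂continuationLaw K h =
      ∑' k, ENNReal.ofReal (γ (h.length + k)) * expect K (k + 1) (lastReward rew) h := by
    rw [lintegral_tsum fun k => (hterm k).aemeasurable]
    refine tsum_congr fun k => ?_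
    rw [← lintegral_continuationLaw, ← lintegral_const_mul' _ _ ENNReal.ofReal_ne_top]
    refine lintegral_congr fun ω => ?_
    rw [history_succ, ← List.append_assoc, ENNReal.ofReal_mul (hγ _)]
    simp [lastReward]
  have ht : ∑' k, ENNReal.ofReal (γ (h.length + k)) * expect K (k + 1) (lastReward rew) h ≠ ∞ := by
    refine ne_top_of_le_ne_top (Summable.tsum_ofReal_ne_top (summable_tail hs h.length))
      (ENNReal.tsum_le_tsum fun k => ?_)
    exact mul_le_of_le_one_right' (expect_le_one (lastReward_le_one hrew) _ _)
  rw [value]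
  simp only [e1]
  rw [integral_toReal hG.aemeasurable (ae_of_all _ hGt), e2,
    ENNReal.ofReal_mul (one_div_nonneg.2 (hΓ _).le), ENNReal.ofReal_toReal ht,
    ← ENNReal.tsum_mul_left]
  refine tsum_congr fun k => ?_
  rw [discountWeight, one_div, div_eq_inv_mul, ENNReal.ofReal_mul (inv_nonneg.2 (hΓ _).le),
    mul_assoc]

theorem value_nonneg (hγ : ∀ t, 0 ≤ γ t) {rew : S → ℝ} (hrew0 : ∀ s, 0 ≤ rew s)
    (K : List S → PMF S) (h : List S) : 0 ≤ value γ rew K h :=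
  mul_nonneg (one_div_nonneg.2 (tsum_nonneg fun _ => hγ _))
    (integral_nonneg fun _ => tsum_nonneg fun _ => mul_nonneg (hγ _) (hrew0 _))

theorem value_le_one (hγ : ∀ t, 0 ≤ γ t) (hs : Summable γ) (hΓ : ∀ t, 0 < tailSum γ t)
    {rew : S → ℝ} (hrew0 : ∀ s, 0 ≤ rew s) (hrew : ∀ s, rew s ≤ 1) (K : List S → PMF S)
    (h : List S) : value γ rew K h ≤ 1 := by
  rw [← ENNReal.ofReal_le_one, ofReal_value hγ hs hΓ hrew0 hrew,
    ← tsum_discountWeight hγ hs hΓ h.length]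
  exact ENNReal.tsum_le_tsum fun k =>
    mul_le_of_le_one_right' (expect_le_one (lastReward_le_one hrew) _ _)

theorem value_map (hγ : ∀ t, 0 ≤ γ t) (hs : Summable γ) (hΓ : ∀ t, 0 < tailSum γ t)
    {S' : Type*} [Countable S'] [MeasurableSpace S'] [DiscreteMeasurableSpace S']
    {rew : S' → ℝ} (hrew0 : ∀ s, 0 ≤ rew s) (hrew : ∀ s, rew s ≤ 1) {K : List S → PMF S}
    {K' : List S' → PMF S'} (p : S → S') (hK : ∀ h, (K h).map p = K' (h.map p)) (h : List S) :
    value γ rew K' (h.map p) = value γ (fun s => rew (p s)) K h := by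
  rw [← ENNReal.ofReal_eq_ofReal_iff (value_nonneg hγ hrew0 _ _)
    (value_nonneg hγ (fun s => hrew0 (p s)) _ _), ofReal_value hγ hs hΓ hrew0 hrew,
    ofReal_value hγ hs hΓ (fun s => hrew0 (p s)) (fun s => hrew (p s)), List.length_map]
  refine tsum_congr fun k => ?_
  rw [← expect_comp_map p hK]
  simp only [lastReward_map]

/-- Values are close if the expected rewards within the effective horizon are close. -/
theorem ofReal_value_le_add (hγ : ∀ t, 0 ≤ γ t) (hs : Summable γ) (hΓ : ∀ t, 0 < tailSum γ t)
    {rew : S → ℝ} (hrew0 : ∀ s, 0 ≤ rew s) (hrew : ∀ s, rew s ≤ 1) {K₁ K₂ : List S → PMF S}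
    {h : List S} {m : ℕ} {d : ℝ≥0∞}
    (hd : ∀ k < m, expect K₁ (k + 1) (lastReward rew) h ≤
      expect K₂ (k + 1) (lastReward rew) h + d) :
    ENNReal.ofReal (value γ rew K₁ h) ≤ ENNReal.ofReal (value γ rew K₂ h) + d +
      ENNReal.ofReal (tailSum γ (h.length + m) / tailSum γ h.length) := by
  rw [ofReal_value hγ hs hΓ hrew0 hrew, ofReal_value hγ hs hΓ hrew0 hrew,
    ← tsum_discountWeight_add hγ hs, ← ENNReal.summable.sum_add_tsum_nat_add' (k := m)]
  gcongr with k
  · calc _ ≤ ∑ k ∈ Finset.range m, (discountWeight γ h.length k *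
          expect K₂ (k + 1) (lastReward rew) h + discountWeight γ h.length k * d) :=
          Finset.sum_le_sum fun k hk => by
            rw [← mul_add]
            gcongr
            exact hd k (Finset.mem_range.1 hk)
      _ ≤ ∑' k, (discountWeight γ h.length k *
          expect K₂ (k + 1) (lastReward rew) h + discountWeight γ h.length k * d) :=
          ENNReal.sum_le_tsum _
      _ = _ := by
          rw [ENNReal.tsum_add, ENNReal.tsum_mul_right, tsum_discountWeight hγ hs hΓ, one_mul]
  · exact mul_le_of_le_one_right' (expect_le_one (lastReward_le_one hrew) _ _)

end Value

/-! ### Mentor-level reward acquisition -/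

section Final

variable {A O : Type*} {R : Set ℝ}

/-- Exploration compares `(π, ν)` with the joint mixture `(π', ν')`, but optimality of `π*` needs
`ν` replaced by `ν'` under the same policy. The extra error `π' - π` is a marginal of the joint
difference. -/
theorem stepTV_le_add_stepTV {πs : Policy A O R} {π π' : List (EInteraction A O R) → PMF A}
    {ν ν' : Environment A O R} (h : List (EInteraction A O R)) :
    stepTV (exploreStep πs π ν) (exploreStep πs π ν') h ≤
      stepTV (exploreStep πs π ν) (exploreStep πs π' ν') h +
        stepTV (exploreStep πs π' ν') (exploreStep πs π ν) h := by
  have split (π₁ π₂ : List (EInteraction A O R) → PMF A) (ν₁ ν₂ : Environment A O R) :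
      stepTV (exploreStep πs π₁ ν₁) (exploreStep πs π₂ ν₂) h =
        ∑' a, ∑' x, (π₁ h a * ν₁ (forget h) a x - π₂ h a * ν₂ (forget h) a x) := by
    rw [stepTV, ENNReal.tsum_prod', tsum_bool, ENNReal.tsum_prod', ENNReal.tsum_prod']
    simp [mixedStep_apply]
  rw [split, split, split, ← ENNReal.tsum_add]
  refine ENNReal.tsum_le_tsum fun a => ?_
  have marg : π' h a - π h a ≤
      ∑' x, (π' h a * ν' (forget h) a x - π h a * ν (forget h) a x) := by
    rw [tsub_le_iff_left]
    calc π' h a = ∑' x, π' h a * ν' (forget h) a x := by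
          rw [ENNReal.tsum_mul_left, PMF.tsum_coe, mul_one]
      _ ≤ ∑' x, (π h a * ν (forget h) a x +
            (π' h a * ν' (forget h) a x - π h a * ν (forget h) a x)) :=
          ENNReal.tsum_le_tsum fun x => le_add_tsub
      _ = _ := by rw [ENNReal.tsum_add, ENNReal.tsum_mul_left, PMF.tsum_coe, mul_one]
  calc _ ≤ ∑' x, ((π h a * ν (forget h) a x - π' h a * ν' (forget h) a x) +
        (π' h a - π h a) * ν' (forget h) a x) := by
        refine ENNReal.tsum_le_tsum fun x => ?_
        rw [tsub_le_iff_right]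
        calc π h a * ν (forget h) a x ≤ (π h a * ν (forget h) a x - π' h a * ν' (forget h) a x) +
              π' h a * ν' (forget h) a x := le_tsub_add
          _ ≤ (π h a * ν (forget h) a x - π' h a * ν' (forget h) a x) +
              ((π' h a - π h a) + π h a) * ν' (forget h) a x := by
              gcongr
              exact le_tsub_add
          _ = _ := by rw [add_mul, add_assoc]
    _ ≤ _ := by
        rw [ENNReal.tsum_add, ENNReal.tsum_mul_left, PMF.tsum_coe, mul_one]
        gcongr

theorem stepTV_exploit_le {b : List (EInteraction A O R) → ℝ≥0∞} {hb : ∀ h, b h ≤ 1}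
    {πs : Policy A O R} {π : List (EInteraction A O R) → PMF A} {ν : Environment A O R}
    (h : List (EInteraction A O R)) :
    stepTV (mixedStep (fun _ => 0) (fun _ => zero_le) πs π ν) (mixedStep b hb πs π ν) h ≤ b h := by
  set K₀ := mixedStep (fun _ => 0) (fun _ => zero_le) πs π ν
  calc _ ≤ ∑' s, b h * K₀ h s := by
        refine ENNReal.tsum_le_tsum fun s => ?_
        rw [tsub_le_iff_left]
        obtain ⟨e, a, x⟩ := s
        cases e
        · simp only [K₀, mixedStep_apply, Bool.false_eq_true, if_false, tsub_zero, one_mul]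
          rw [mul_assoc, ← add_mul, tsub_add_cancel_of_le (hb h), one_mul]
        · simp [K₀, mixedStep_apply]
    _ = b h := by rw [ENNReal.tsum_mul_left, PMF.tsum_coe, mul_one]

theorem sum_expect_le_of_le_stepKL {S : Type*} {K₁ K₂ : List S → PMF S} {d : List S → ℝ≥0∞}
    {G : List S → Prop} (hG : ∀ h s, G h → K₁ h s ≠ 0 → G (h ++ [s])) {c c' : ℝ≥0∞}
    (hd : ∀ h, G h → d h ≤ c + c' * stepKL K₁ K₂ h) {k m : ℕ} (hk : k < m) {h : List S}
    (hh : G h) :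
    ∑ j ∈ Finset.range (k + 1), expect K₁ j d h ≤ m * c + c' * pathKL K₁ K₂ m h := by
  calc _ ≤ ∑ j ∈ Finset.range m, expect K₁ j d h :=
        Finset.sum_le_sum_of_subset (Finset.range_mono hk)
    _ ≤ ∑ j ∈ Finset.range m, (c + c' * expect K₁ j (stepKL K₁ K₂) h) := by
        refine Finset.sum_le_sum fun j _ => ?_
        refine (expect_le_of_closed hG j hd h hh).trans_eq ?_
        rw [expect_add, expect_const, expect_const_mul]
    _ = _ := by
        rw [Finset.sum_add_distrib, Finset.sum_const, Finset.card_range, nsmul_eq_mul, pathKL,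
          Finset.mul_sum]

variable [Countable A] [MeasurableSpace A] [DiscreteMeasurableSpace A]
  [Countable O] [MeasurableSpace O] [DiscreteMeasurableSpace O] [Countable R]
  {M : Set (Environment A O R)} {P : Set (Policy A O R)} {wM : PMF M} {wP : PMF P} {η : ℝ}
  {γ : ℕ → ℝ} {πs : Policy A O R}

/-- The mentor's value exceeds Mentee's value at most by what is left to learn. -/
theorem policyValue_le_menteeValue_add (hR : R ⊆ Set.Icc 0 1) (hγ : ∀ t, 0 ≤ γ t)
    (hs : Summable γ) (hΓ : ∀ t, 0 < tailSum γ t)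
    (hπs : IsOptimalPolicy γ (mixtureEnv wM) πs) (i : M × P) (m : ℕ) {δ : ℝ} (hδ : 0 < δ)
    (ε : ℝ≥0∞) {h : List (EInteraction A O R)} (hh : Possible wM wP h)
    (hi : posteriorWeight wM wP h i ≠ 0) :
    ENNReal.ofReal (policyValue γ i.2.1 i.1.1 (forget h)) ≤
      ENNReal.ofReal (menteeValue γ wM wP η i.2.1 πs i.1.1 h) +
      (m * (2 * ENNReal.ofReal δ) + ENNReal.ofReal δ⁻¹ *
        pathKL (menteeStep wM wP η i.2.1 πs i.1.1) (mixtureStep wM wP η πs) m h) +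
      (m * ε + ∑ j ∈ Finset.range m, expect (mixtureStep wM wP η πs) j
        (fun g => explorationProb wM wP η g - ε) h) +
      (m * (2 * (2 * ENNReal.ofReal δ)) + 2 * ENNReal.ofReal δ⁻¹ *
        pathKL (exploreStep πs (fun h => i.2.1 (forget h)) i.1.1)
          (exploreStep πs (mixturePolicy wP) (mixtureEnv wM)) m h) +
      3 * ENNReal.ofReal (tailSum γ (h.length + m) / tailSum γ h.length) := by
  have hr0 (s : Interaction A O R) : 0 ≤ reward s := (hR s.2.2.2).1
  have hr1 (s : Interaction A O R) : reward s ≤ 1 := (hR s.2.2.2).2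
  have hr0' (s : EInteraction A O R) : 0 ≤ reward s.2 := hr0 s.2
  have hr1' (s : EInteraction A O R) : reward s.2 ≤ 1 := hr1 s.2
  set rew : EInteraction A O R → ℝ := fun s => reward s.2
  have hF := lastReward_le_one (rew := rew) hr1'
  have BP := isBayesMixture_mentee wM wP η πs
  have BX := isBayesMixture wM wP (fun _ => 1) (fun _ => le_rfl) πs
  -- Values without indicators become values of the processes that always (`v₁`, `v₂`) or never
  -- (`v₃`) explore, so that all comparisons live on histories with indicators.
  have v₁ := value_map hγ hs hΓ hr0 hr1 (K := exploreStep πs (fun h => i.2.1 (forget h)) i.1.1)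
    Prod.snd (fun h => map_snd_mixedStep_one h i.2.1) h
  have v₂ := value_map hγ hs hΓ hr0 hr1
    (K := exploreStep πs (fun h => i.2.1 (forget h)) (mixtureEnv wM))
    Prod.snd (fun h => map_snd_mixedStep_one h i.2.1) h
  have v₃ := value_map hγ hs hΓ hr0 hr1
    (K := mixedStep (fun _ => 0) (fun _ => zero_le) πs (mixturePolicy wP) (mixtureEnv wM))
    Prod.snd (fun h => map_snd_mixedStep_zero h) h
  have opt := ENNReal.ofReal_le_ofReal (hπs (forget h) i.2.1)
  change ENNReal.ofReal (value γ reward _ (h.map Prod.snd)) ≤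
    ENNReal.ofReal (value γ reward _ (h.map Prod.snd)) at opt
  rw [v₂, v₃] at opt
  change ENNReal.ofReal (value γ reward _ (h.map Prod.snd)) ≤ _
  rw [v₁]
  -- Mentor in the true environment against mentor in `ξ`; the doubled constants come from the two
  -- directions of total variation.
  have c₁ := ofReal_value_le_add hγ hs hΓ hr0' hr1' (h := h) (m := m)
    (K₁ := exploreStep πs (fun h => i.2.1 (forget h)) i.1.1)
    (K₂ := exploreStep πs (fun h => i.2.1 (forget h)) (mixtureEnv wM)) fun k hk =>
    (expect_le_add_stepTV _ _ hF (k + 1) h).trans (add_le_add_right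
      (sum_expect_le_of_le_stepKL (c := 2 * (2 * ENNReal.ofReal δ))
        (c' := 2 * ENNReal.ofReal δ⁻¹)
        (K₂ := exploreStep πs (mixturePolicy wP) (mixtureEnv wM))
        (G := fun g => Possible wM wP g ∧ posteriorWeight wM wP g i ≠ 0)
        (fun g s hg hs => BX.good_append_of_ne_zero hg hs) (fun g hg => by
          refine (stepTV_le_add_stepTV (π' := mixturePolicy wP) g).trans ?_
          have := max_le_iff.1 (max_stepTV_le (BX.eq_zero_of_mixture_eq_zero hg.1 hg.2) hδ)
          rw [mul_assoc, ← mul_add, two_mul (2 * ENNReal.ofReal δ + _)]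
          exact add_le_add this.1 this.2) hk ⟨hh, hi⟩) _)
  -- Pure exploitation in `ξ` against the mixture process, which differ per step by at most `β ≤ ε +
  -- (β - ε)`, averaged along the mixture.
  have c₂ := ofReal_value_le_add hγ hs hΓ hr0' hr1' (h := h) (m := m)
    (K₁ := mixedStep (fun _ => 0) (fun _ => zero_le) πs (mixturePolicy wP) (mixtureEnv wM))
    (K₂ := mixtureStep wM wP η πs) fun k hk =>
    (expect_le_add_stepTV' _ _ hF (k + 1) h).trans (add_le_add_right
      (c := m * ε + ∑ j ∈ Finset.range m, expect (mixtureStep wM wP η πs) j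
        (fun g => explorationProb wM wP η g - ε) h) (by
        calc _ ≤ ∑ j ∈ Finset.range m, expect (mixtureStep wM wP η πs) j (stepTV _ _) h :=
              Finset.sum_le_sum_of_subset (Finset.range_mono hk)
          _ ≤ ∑ j ∈ Finset.range m, expect (mixtureStep wM wP η πs) j
                (fun g => ε + (explorationProb wM wP η g - ε)) h :=
              Finset.sum_le_sum fun j _ => expect_mono j
                (fun g => (stepTV_exploit_le g).trans le_add_tsub) h
          _ = _ := by
              simp only [expect_add, expect_const]
              rw [Finset.sum_add_distrib, Finset.sum_const, Finset.card_range, nsmul_eq_mul]) _)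
  -- Mixture process against Mentee with the true mentor and environment, with errors averaged along
  -- the latter.
  have c₃ := ofReal_value_le_add hγ hs hΓ hr0' hr1' (h := h) (m := m)
    (K₁ := mixtureStep wM wP η πs) (K₂ := menteeStep wM wP η i.2.1 πs i.1.1) fun k hk =>
    (expect_le_add_stepTV' _ _ hF (k + 1) h).trans (add_le_add_right
      (sum_expect_le_of_le_stepKL (c := 2 * ENNReal.ofReal δ) (c' := ENNReal.ofReal δ⁻¹)
        (K₂ := mixtureStep wM wP η πs)
        (G := fun g => Possible wM wP g ∧ posteriorWeight wM wP g i ≠ 0)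
        (fun g s hg hs => BP.good_append_of_ne_zero hg hs) (fun g hg =>
          (max_le_iff.1 (max_stepTV_le (BP.eq_zero_of_mixture_eq_zero hg.1 hg.2) hδ)).2)
        hk ⟨hh, hi⟩) _)
  calc _ ≤ _ := c₁
    _ ≤ _ := add_le_add_left (add_le_add_left (opt.trans (c₂.trans
        (add_le_add_left (add_le_add_left c₃ _) _))) _) _
    _ = _ := by
      rw [menteeValue]
      ring

end Final

/-! ### Passage to the limit -/

section Limit

theorem tendsto_const_mul_zero {α : Type*} {l : Filter α} {f : α → ℝ≥0∞} {c : ℝ≥0∞}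
    (hc : c ≠ ∞) (h : Tendsto f l (nhds 0)) : Tendsto (fun t => c * f t) l (nhds 0) := by
  simpa using ENNReal.Tendsto.const_mul h (Or.inr hc)

variable {A O : Type*} {R : Set ℝ} [Countable A] [MeasurableSpace A] [DiscreteMeasurableSpace A]
  [Countable O] [MeasurableSpace O] [DiscreteMeasurableSpace O] [Countable R]
  {M : Set (Environment A O R)} {P : Set (Policy A O R)} {wM : PMF M} {wP : PMF P} {η : ℝ}

/-- Once the truncated term is below one, the minimum is attained by the information value itself.
-/
theorem tendsto_infoGainValue {α : Type*} {l : Filter α} {g : α → List (EInteraction A O R)}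
    (hη : 0 < η) {m : ℕ} (hm : m ≠ 0)
    (h : Tendsto (fun t => explorationTerm wM wP η m (g t) ^ (m + 1)) l (nhds 0)) :
    Tendsto (fun t => infoGainValue wM wP m (g t)) l (nhds 0) := by
  rw [ENNReal.tendsto_nhds_zero]
  intro ε hε
  have ha : ENNReal.ofReal (η / m) ≠ 0 := by
    have : 0 < (m : ℝ) := by positivity
    exact (ENNReal.ofReal_pos.2 (by positivity)).ne'
  have hpos : 0 < min 1 (ENNReal.ofReal (η / m) * ε) :=
    lt_min one_pos (ENNReal.mul_pos ha hε.ne')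
  filter_upwards [h.eventually_lt_const (pos_iff_ne_zero.2 (pow_ne_zero (m + 1) hpos.ne'))]
    with t ht
  have hlt := lt_of_pow_lt_pow_left' _ ht
  by_contra hcon
  refine absurd hlt (not_lt.2 (min_le_min_left 1 ?_))
  gcongr
  exact (not_le.1 hcon).le

/-- Mentor-level reward acquisition, for arbitrary classes of environments and policies. -/
theorem ae_liminf_menteeValue_sub_policyValue_nonneg (hR : R ⊆ Set.Icc 0 1)
    {γ : ℕ → ℝ} (hγ : ∀ t, 0 ≤ γ t) (hγ_summable : Summable γ) (hΓ : ∀ t, 0 < tailSum γ t)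
    (hγ_horizon : BoundedHorizon γ) (hwM : FiniteEntropy wM) (hwP : FiniteEntropy wP)
    (hη : 0 < η) {μ : M} (hμ : wM μ ≠ 0) {πh : P} (hπh : wP πh ≠ 0) {πs : Policy A O R}
    (hπs : IsOptimalPolicy γ (mixtureEnv wM) πs) :
    ∀ᵐ ω ∂menteeLaw wM wP η πh.1 πs μ.1,
      0 ≤ liminf (fun t : ℕ => menteeValue γ wM wP η πh.1 πs μ.1 (history ω t) -
        policyValue γ πh.1 μ.1 (forget (history ω t))) atTop := by
  have B := isBayesMixture_mentee wM wP η πs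
  have hi : posteriorWeight wM wP [] (μ, πh) ≠ 0 := by
    rw [posteriorWeight_nil]
    exact mul_ne_zero hμ hπh
  have hnil := possible_nil wM wP
  have a₁ := B.ae_eventually_good hnil hi
  have a₂ := B.ae_exists_le hnil hi
  have a₃ := ae_all_iff.2 fun m : {m : ℕ // m ≠ 0} => B.ae_tendsto_zero hnil hi
    (tsum_expect_explorationTerm_pow_ne_top (η := η) hwM hwP πs m.2)
  -- Only the countably many tolerances `1 / (n + 1)` are used, so that one null set serves them
  -- all.
  have a₄ := ae_all_iff.2 fun mn : ℕ × ℕ => B.ae_tendsto_zero hnil hi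
    (f := fun g => ∑ j ∈ Finset.range mn.1, expect (mixtureStep wM wP η πs) j
      (fun g => explorationProb wM wP η g - ((mn.2 : ℝ≥0∞) + 1)⁻¹) g)
    (ne_top_of_le_ne_top (ENNReal.mul_ne_top (ENNReal.natCast_ne_top _)
      (tsum_expect_explorationProb_sub_ne_top hwM hwP πs
        (ENNReal.inv_ne_zero.2 (by finiteness))))
      (tsum_expect_sum_expect_le _ _ _ _))
  have a₅ := ae_all_iff.2 fun m : ℕ => ae_tendsto_zero_of_tsum_expect
    (K := menteeStep wM wP η πh.1 πs μ.1)
    (f := pathKL (menteeStep wM wP η πh.1 πs μ.1) (mixtureStep wM wP η πs) m)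
    (ne_top_of_le_ne_top (ENNReal.mul_ne_top (ENNReal.natCast_ne_top m)
      (ne_top_of_le_ne_top ENNReal.ofReal_ne_top (B.tsum_expect_stepKL_le ⟨hnil, hi⟩)))
      (tsum_expect_sum_expect_le _ m _ []))
  change ∀ᵐ ω ∂continuationLaw (menteeStep wM wP η πh.1 πs μ.1) [], _
  filter_upwards [a₁, a₂, a₃, a₄, a₅] with ω h₁ ⟨θ, hθ, h₂⟩ h₃ h₄ h₅
  have hr0 (s : Interaction A O R) : 0 ≤ reward s := (hR s.2.2.2).1
  have hr1 (s : Interaction A O R) : reward s ≤ 1 := (hR s.2.2.2).2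
  have hv0 (t : ℕ) : 0 ≤ menteeValue γ wM wP η πh.1 πs μ.1 (history ω t) :=
    value_nonneg hγ (fun s : EInteraction A O R => hr0 s.2) _ _
  -- The error terms cost `3 + 2 + 5` multiples of `ε`, and the three truncations at the horizon
  -- another 3.
  have key : ∀ ε : ℝ, 0 < ε → ∀ᶠ t in atTop, -(13 * ε) ≤
      menteeValue γ wM wP η πh.1 πs μ.1 (history ω t) -
        policyValue γ πh.1 μ.1 (forget (history ω t)) := by
    intro ε hε
    have hε' : 0 < ENNReal.ofReal ε := ENNReal.ofReal_pos.2 hε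
    obtain ⟨m, hm⟩ := hγ_horizon ε hε
    set δ : ℝ := ε / (m + 1) with hδdef
    have hδ : 0 < δ := by positivity
    have hmδ : (m : ℝ≥0∞) * ENNReal.ofReal δ ≤ ENNReal.ofReal ε := by
      rw [← ENNReal.ofReal_natCast, ← ENNReal.ofReal_mul (Nat.cast_nonneg m)]
      refine ENNReal.ofReal_le_ofReal ?_
      rw [hδdef, mul_div_assoc', div_le_iff₀ (by positivity)]
      nlinarith
    obtain ⟨n, hn⟩ : ∃ n : ℕ, (m : ℝ≥0∞) * ((n : ℝ≥0∞) + 1)⁻¹ ≤ ENNReal.ofReal ε := by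
      obtain ⟨n, hn⟩ := exists_nat_ge (m / ε)
      refine ⟨n, ?_⟩
      rw [← ENNReal.ofReal_natCast, ← ENNReal.ofReal_natCast, ← ENNReal.ofReal_one,
        ← ENNReal.ofReal_add (by positivity) zero_le_one,
        ← ENNReal.ofReal_inv_of_pos (by positivity), ← ENNReal.ofReal_mul (by positivity)]
      refine ENNReal.ofReal_le_ofReal ?_
      rw [← div_eq_mul_inv, div_le_iff₀ (by positivity)]
      rw [div_le_iff₀ hε] at hn
      nlinarith
    have t₁ : Tendsto (fun t => ENNReal.ofReal δ⁻¹ *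
        pathKL (menteeStep wM wP η πh.1 πs μ.1) (mixtureStep wM wP η πs) m (history ω t))
        atTop (nhds 0) := tendsto_const_mul_zero ENNReal.ofReal_ne_top (h₅ m)
    -- The horizon `m` can be 0 when `ε > 1`; `β` then carries no information about it, and none is
    -- needed.
    have t₂ : Tendsto (fun t => 2 * ENNReal.ofReal δ⁻¹ * (θ⁻¹ *
        if m = 0 then 0 else infoGainValue wM wP m (history ω t))) atTop (nhds 0) := by
      refine tendsto_const_mul_zero (by finiteness)
        (tendsto_const_mul_zero (ENNReal.inv_ne_top.2 hθ) ?_)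
      by_cases hm0 : m = 0
      · simp [hm0]
      · simp only [hm0, if_false]
        exact tendsto_infoGainValue hη hm0 (h₃ ⟨m, hm0⟩)
    filter_upwards [h₁, t₁.eventually_le_const hε', t₂.eventually_le_const hε',
      (h₄ (m, n)).eventually_le_const hε'] with t g₀ g₁ g₂ g₃
    have hW : posteriorWeight wM wP (history ω t) (μ, πh) ≠ 0 :=
      ((pos_iff_ne_zero.2 hθ).trans_le (h₂ t)).ne'
    -- The information value is a posterior average in which the true pair has weight at least `θ`.
    have hX : pathKL (exploreStep πs (fun h => πh.1 (forget h)) μ.1)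
        (exploreStep πs (mixturePolicy wP) (mixtureEnv wM)) m (history ω t) ≤
        θ⁻¹ * if m = 0 then 0 else infoGainValue wM wP m (history ω t) := by
      by_cases hm0 : m = 0
      · simp [hm0, pathKL]
      · have hθt : θ ≠ ∞ :=
          ne_top_of_le_ne_top ENNReal.one_ne_top ((h₂ 0).trans (B.le_one _ _))
        rw [if_neg hm0, infoGainValue_eq πs m g₀, mul_comm, ← div_eq_mul_inv,
          ENNReal.le_div_iff_mul_le (Or.inl hθ) (Or.inl hθt), mul_comm]
        refine le_trans ?_ (ENNReal.le_tsum (μ, πh))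
        gcongr
        exact h₂ t
    have main := policyValue_le_menteeValue_add (η := η) hR hγ hγ_summable hΓ hπs (μ, πh) m hδ
      ((n : ℝ≥0∞) + 1)⁻¹ g₀ hW
    have total : ENNReal.ofReal (policyValue γ πh.1 μ.1 (forget (history ω t))) ≤
        ENNReal.ofReal (menteeValue γ wM wP η πh.1 πs μ.1 (history ω t) + 13 * ε) := by
      rw [ENNReal.ofReal_add (hv0 t) (by positivity)]
      refine main.trans ?_
      have e1 : (m : ℝ≥0∞) * (2 * ENNReal.ofReal δ) ≤ 2 * ENNReal.ofReal ε := by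
        rw [mul_left_comm]
        gcongr
      have e2 : (m : ℝ≥0∞) * (2 * (2 * ENNReal.ofReal δ)) ≤ 2 * (2 * ENNReal.ofReal ε) := by
        rw [mul_left_comm]
        gcongr
      have e3 : ENNReal.ofReal (tailSum γ ((history ω t).length + m) /
          tailSum γ (history ω t).length) ≤ ENNReal.ofReal ε :=
        ENNReal.ofReal_le_ofReal (hm _).le
      calc _ ≤ ENNReal.ofReal (menteeValue γ wM wP η πh.1 πs μ.1 (history ω t)) +
            (2 * ENNReal.ofReal ε + ENNReal.ofReal ε) + (ENNReal.ofReal ε + ENNReal.ofReal ε) +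
            (2 * (2 * ENNReal.ofReal ε) + ENNReal.ofReal ε) + 3 * ENNReal.ofReal ε := by
            gcongr
            exact le_trans (by gcongr) g₂
        _ = _ := by
            rw [ENNReal.ofReal_mul (by norm_num), ENNReal.ofReal_ofNat]
            ring
    have := (ENNReal.ofReal_le_ofReal_iff (add_nonneg (hv0 t) (by positivity))).1 total
    linarith
  refine le_of_forall_pos_sub_le fun ε hε => ?_
  rw [zero_sub]
  refine le_liminf_of_le ?_ ((key (ε / 13) (by positivity)).mono fun t ht => by linarith)
  -- A real `liminf` is meaningful only for bounded families; the difference of values is at most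
  -- one.
  refine IsBoundedUnder.isCoboundedUnder_ge ⟨1, eventually_map.2 (Eventually.of_forall fun t => ?_)⟩
  have b₁ : menteeValue γ wM wP η πh.1 πs μ.1 (history ω t) ≤ 1 :=
    value_le_one hγ hγ_summable hΓ (fun s : EInteraction A O R => hr0 s.2) (fun s => hr1 s.2) _ _
  have b₂ : 0 ≤ policyValue γ πh.1 μ.1 (forget (history ω t)) := value_nonneg hγ hr0 _ _
  linarith

end Limit

end Mentee

end

theorem theorem4 {A O : Type*}
    [Primcodable A] [MeasurableSpace A] [DiscreteMeasurableSpace A]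
    [Primcodable O] [MeasurableSpace O] [DiscreteMeasurableSpace O]
    (R : Set ℝ) [Primcodable R] (hR : R ⊆ Set.Icc 0 1)
    (γ : ℕ → ℝ) (hγ : ∀ t, 0 ≤ γ t) (hγ_summable : Summable γ)
    (hΓ : ∀ t, 0 < Mentee.tailSum γ t) (hγ_horizon : Mentee.BoundedHorizon γ)
    (wM : PMF (Mentee.computableEnvironments A O R)) (hwM : Mentee.FiniteEntropy wM)
    (P : Set (Mentee.Policy A O R)) (hP : P.Countable)
    (wP : PMF P) (hwP : Mentee.FiniteEntropy wP)
    (η : ℝ) (hη : 0 < η)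
    (μ : Mentee.computableEnvironments A O R) (hμ : wM μ ≠ 0)
    (πh : P) (hπh : wP πh ≠ 0)
    (πs : Mentee.Policy A O R)
    (hπs : Mentee.IsOptimalPolicy γ (Mentee.mixtureEnv wM) πs) :
    ∀ᵐ ω ∂(Mentee.menteeLaw wM wP η πh.1 πs μ.1),
      0 ≤ Filter.liminf (fun t : ℕ =>
        Mentee.menteeValue γ wM wP η πh.1 πs μ.1 (Mentee.history ω t) -
          Mentee.policyValue γ πh.1 μ.1 (Mentee.forget (Mentee.history ω t))) Filter.atTop := by
  exact Mentee.ae_liminf_menteeValue_sub_policyValue_nonneg hR hγ hγ_summable hΓ hγ_horizon hwM hwP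
    hη hμ hπh hπs
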